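/- Let $\langle x,y\rangle=x_1y_1+\cdots+x_5y_5-x_6y_6$ on $\mathbb{R}^{5,1}$, let $\mathbb{H}^5=\{x : \langle x,x\rangle=-1,\ x_6>0\}$ be the hyperboloid model of hyperbolic $5$-space, and identify $\mathrm{Isom}(\mathbb{H}^5)$ (with its usual topology) with the positive Lorentz group, that is, the group of real invertible $6\times 6$ matrices preserving $\langle\cdot,\cdot\rangle$ and $\mathbb{H}^5$. Let $V$ be the set of the following $48$ unit space-like vectors: - (i) the $8$ vectors obtained by permuting the first four coordinates of $(\pm1,0,0,0,1,1)$; - (ii) the $8$ vectors obtained by permuting the first four coordinates of $(\pm1,0,0,0,-\tfrac12,\tfrac12)$; - (iii) the $32$ vectors obtained by permuting the first four coordinates of $(\pm1,\pm1,\pm1,0,\tfrac12,\tfrac32)$. Let $\mathcal{P}=\{x\in\mathbb{H}^5 : \langle x,v\rangle\le 0 \text{ for all } v\in V\}$; for $v\in V$ the facet of $\mathcal P$ defined by $v$ is $\{x\in\mathcal{P} : \langle x,v\rangle=0\}$, and $r_v$ denotes the reflection $x\mapsto x-2\langle x,v\rangle v$. **Theorem.** Let $\mathcal{F}\subseteq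 V$ be any set of vectors whose facets of $\mathcal{P}$ are pairwise disjoint in $\mathbb{H}^5$ (they may meet at infinity; $\mathcal{F}$ may be empty). Let $\Gamma_{\mathcal{F}}$ be the subgroup of $\mathrm{Isom}(\mathbb{H}^5)$ generated by the reflections $r_v$ with $v\in V\setminus\mathcal{F}$, that is, the right-angled Coxeter group obtained from $\Gamma_{\mathcal{P}}$ by removing the facets in $\mathcal{F}$; let $\rho_0$ be its inclusion into $\mathrm{Isom}(\mathbb{H}^5)$, and give $\mathrm{Hom}(\Gamma_{\mathcal{F}},\mathrm{Isom}(\mathbb{H}^5))$ the topology of pointwise convergence. Then there is an open neighbourhood $U_0$ of $\rho_0$ in $\mathrm{Hom}(\Gamma_{\mathcal{F}},\mathrm{Isom}(\mathbb{H}^5))$ such that, for every $\rho\in U_0$, each $\rho(r_v)$ with $v\in V\setminus\mathcal{F}$ is a reflection, and there is $f\in\mathrm{Isom}(\mathbb{H}^5)$ with $f\rho(\gamma)f^{-1}=\rho_0(\gamma)$ for all $\gamma\in\Gamma_{\mathcal{F}}$. In particular $\Gamma_{\mathcal{F}}$ is locally rigid, i.e. some neighbourhood of $\rho_0$ is contained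 in the $\mathrm{Isom}(\mathbb{H}^5)$-conjugation orbit of $\rho_0$. -/

import Mathlib

open Matrix Topology

noncomputable section

namespace HypRACG

/-- The vectors of Lorentzian space `ℝ^{d,1}`; the last coordinate is the time coordinate. -/
abbrev Vec (d : ℕ) := Fin (d + 1) → ℝ

/-- The Lorentzian inner product `x₁y₁ + ⋯ + x_d y_d - x_{d+1} y_{d+1}`. -/
def lform {d : ℕ} (x y : Vec d) : ℝ :=
  ∑ i : Fin d, x i.castSucc * y i.castSucc - x (Fin.last d) * y (Fin.last d)

/-- The hyperboloid model of hyperbolic `d`-space. -/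
def hyperboloid (d : ℕ) : Set (Vec d) :=
  {x | lform x x = -1 ∧ 0 < x (Fin.last d)}

/-- The positive Lorentz group: the invertible matrices that preserve the Lorentzian inner product
and the sheet `hyperboloid d`. -/
def positiveLorentzGroup (d : ℕ) : Subgroup (GL (Fin (d + 1)) ℝ) where
  carrier := {A | (∀ x y : Vec d, lform (A.1 *ᵥ x) (A.1 *ᵥ y) = lform x y) ∧
    ∀ x : Vec d, A.1 *ᵥ x ∈ hyperboloid d ↔ x ∈ hyperboloid d}
  one_mem' := by simp
  mul_mem' := by
    rintro A B ⟨hA, hA'⟩ ⟨hB, hB'⟩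
    refine ⟨fun x y => ?_, fun x => ?_⟩
    · rw [Units.val_mul, ← mulVec_mulVec, ← mulVec_mulVec, hA, hB]
    · rw [Units.val_mul, ← mulVec_mulVec, hA', hB']
  inv_mem' := by
    rintro A ⟨hA, hA'⟩
    have key : ∀ x : Vec d, A.1 *ᵥ ((A⁻¹).1 *ᵥ x) = x := fun x => by
      rw [mulVec_mulVec, Units.mul_inv, one_mulVec]
    refine ⟨fun x y => ?_, fun x => ?_⟩
    · rw [← hA, key, key]
    · rw [← hA', key]

/-- The isometry group of hyperbolic `d`-space, identified with the positive Lorentz group.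
Its topology is the one inherited from the real matrices. -/
abbrev Isom (d : ℕ) := ↥(positiveLorentzGroup d)

/-- Unit space-like vectors. -/
abbrev UnitSpacelike (d : ℕ) := {v : Vec d // lform v v = 1}

/-- The linear map `x ↦ x - 2⟨x, v⟩v`. -/
def reflVec {d : ℕ} (v x : Vec d) : Vec d := x - (2 * lform x v) • v

theorem lform_comm {d : ℕ} (x y : Vec d) : lform x y = lform y x := by
  simp only [lform, mul_comm]

theorem lform_add_left {d : ℕ} (x y z : Vec d) : lform (x + y) z = lform x z + lform y z := by
  simp only [lform, Pi.add_apply, add_mul, Finset.sum_add_distrib]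
  ring

theorem lform_smul_left {d : ℕ} (c : ℝ) (x z : Vec d) : lform (c • x) z = c * lform x z := by
  simp only [lform, Pi.smul_apply, smul_eq_mul, mul_assoc, Finset.mul_sum, mul_sub]

theorem lform_reflVec {d : ℕ} (v : Vec d) (hv : lform v v = 1) (x y : Vec d) :
    lform (reflVec v x) (reflVec v y) = lform x y := by
  have sub : ∀ (c : ℝ) (a b w : Vec d), lform (a - c • b) w = lform a w - c * lform b w := by
    intro c a b w
    rw [sub_eq_add_neg, ← neg_smul, lform_add_left, lform_smul_left]
    ring
  have h1 : ∀ w, lform w (reflVec v y) = lform w y - 2 * lform y v * lform v w := by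
    intro w
    rw [lform_comm, reflVec, sub, lform_comm y w]
  rw [h1]
  unfold reflVec
  rw [sub, lform_comm v (x - _), sub, hv, lform_comm v y]
  ring

theorem reflVec_reflVec {d : ℕ} (v : Vec d) (hv : lform v v = 1) (x : Vec d) :
    reflVec v (reflVec v x) = x := by
  have : lform (reflVec v x) v = - lform x v := by
    unfold reflVec
    rw [sub_eq_add_neg, ← neg_smul, lform_add_left, lform_smul_left, hv]
    ring
  rw [reflVec, this]
  unfold reflVec
  module

theorem reflVec_mem {d : ℕ} (v : Vec d) (hv : lform v v = 1) (x : Vec d)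
    (hx : x ∈ hyperboloid d) : reflVec v x ∈ hyperboloid d := by
  obtain ⟨h1, h2⟩ := hx
  have h3 : lform (reflVec v x) (reflVec v x) = -1 := by rw [lform_reflVec v hv, h1]
  refine ⟨h3, ?_⟩
  by_contra hneg
  have h4 : lform x (reflVec v x) = -1 - 2 * lform x v ^ 2 := by
    rw [lform_comm, reflVec, sub_eq_add_neg, ← neg_smul, lform_add_left, lform_smul_left, h1,
      lform_comm v x]
    ring
  have cs := Finset.sum_mul_sq_le_sq_mul_sq Finset.univ
    (fun i : Fin d => x i.castSucc) (fun i : Fin d => reflVec v x i.castSucc)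
  simp only [lform, ← pow_two] at h1 h3
  have h4' : lform x (reflVec v x) < 0 := by rw [h4]; nlinarith [sq_nonneg (lform x v)]
  unfold lform at h4'
  set s := ∑ i : Fin d, x i.castSucc * reflVec v x i.castSucc
  set p := x (Fin.last d)
  set q := reflVec v x (Fin.last d)
  have e1 : ∑ i : Fin d, x i.castSucc ^ 2 = p ^ 2 - 1 := by linarith
  have e2 : ∑ i : Fin d, reflVec v x i.castSucc ^ 2 = q ^ 2 - 1 := by linarith
  have n1 : 0 ≤ p ^ 2 - 1 := e1 ▸ Finset.sum_nonneg fun i _ => sq_nonneg _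
  have n2 : 0 ≤ q ^ 2 - 1 := e2 ▸ Finset.sum_nonneg fun i _ => sq_nonneg _
  rw [e1, e2] at cs
  have hq : q ≤ 0 := not_lt.mp hneg
  have hpq : p * q ≤ 0 := mul_nonpos_of_nonneg_of_nonpos h2.le hq
  nlinarith

/-- The matrix of `x ↦ x - 2⟨x, v⟩v`. -/
def reflMatrix {d : ℕ} (v : Vec d) : Matrix (Fin (d + 1)) (Fin (d + 1)) ℝ :=
  LinearMap.toMatrix'
    { toFun := reflVec v
      map_add' := fun x y => by
        unfold reflVec; rw [lform_add_left]; module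
      map_smul' := fun c x => by
        unfold reflVec; rw [lform_smul_left, RingHom.id_apply]; module }

theorem reflMatrix_mulVec {d : ℕ} (v x : Vec d) : reflMatrix v *ᵥ x = reflVec v x := by
  rw [reflMatrix, LinearMap.toMatrix'_mulVec]
  rfl

theorem reflMatrix_mul_self {d : ℕ} (v : Vec d) (hv : lform v v = 1) :
    reflMatrix v * reflMatrix v = 1 := by
  refine Matrix.mulVec_injective (funext fun x => ?_)
  rw [← mulVec_mulVec, reflMatrix_mulVec, reflMatrix_mulVec, reflVec_reflVec v hv, one_mulVec]

/-- The reflection of hyperbolic `d`-space in the hyperplane orthogonal to a unit space-like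
vector `v`. -/
def reflection {d : ℕ} (v : UnitSpacelike d) : Isom d :=
  ⟨⟨reflMatrix v.1, reflMatrix v.1, reflMatrix_mul_self v.1 v.2, reflMatrix_mul_self v.1 v.2⟩,
    by
      refine ⟨fun x y => ?_, fun x => ?_⟩
      · simp only [reflMatrix_mulVec, lform_reflVec v.1 v.2]
      · simp only [reflMatrix_mulVec]
        refine ⟨fun h => ?_, reflVec_mem v.1 v.2 x⟩
        have := reflVec_mem v.1 v.2 _ h
        rwa [reflVec_reflVec v.1 v.2] at this⟩

/-- The hyperplane of hyperbolic `d`-space with normal vector `v`. -/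
def hyperplane {d : ℕ} (v : Vec d) : Set (Vec d) := {x ∈ hyperboloid d | lform x v = 0}

/-- The closed half-space of hyperbolic `d`-space with outer normal vector `v`. -/
def halfSpace {d : ℕ} (v : Vec d) : Set (Vec d) := {x ∈ hyperboloid d | lform x v ≤ 0}

/-- The polytope cut out by the half-spaces with outer normal vectors in `N`. -/
def polytope {d : ℕ} (N : Set (Vec d)) : Set (Vec d) :=
  {x ∈ hyperboloid d | ∀ v ∈ N, x ∈ halfSpace v}

/-- The facet of `polytope N` on the hyperplane with normal vector `v`. -/
def facet {d : ℕ} (N : Set (Vec d)) (v : Vec d) : Set (Vec d) := polytope N ∩ hyperplane v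

/-- The reflections in the hyperplanes whose unit normal vectors lie in `N`. -/
def reflections {d : ℕ} (N : Set (Vec d)) : Set (Isom d) :=
  {g | ∃ v : UnitSpacelike d, v.1 ∈ N ∧ g = reflection v}

/-- The group generated by the reflections in the hyperplanes with unit normal vectors in `N`. -/
def reflectionGroup {d : ℕ} (N : Set (Vec d)) : Subgroup (Isom d) :=
  Subgroup.closure (reflections N)

/-- The representation space `Hom(Γ, Isom ℍ^d)`. -/
abbrev RepSpace {d : ℕ} (Γ : Subgroup (Isom d)) := ↥Γ →* Isom d

/-- The topology of pointwise convergence on the representation space. -/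
instance {d : ℕ} (Γ : Subgroup (Isom d)) : TopologicalSpace (RepSpace Γ) :=
  TopologicalSpace.induced (fun ρ γ => ρ γ) (inferInstance : TopologicalSpace (↥Γ → Isom d))

/-- The inclusion of `Γ`, as a point of the representation space. -/
def inclusionRep {d : ℕ} (Γ : Subgroup (Isom d)) : RepSpace Γ := Γ.subtype

/-- Some neighbourhood of the inclusion consists of conjugates of the inclusion. -/
def LocallyRigid {d : ℕ} (Γ : Subgroup (Isom d)) : Prop :=
  ∃ U ∈ 𝓝 (inclusionRep Γ), ∀ ρ ∈ U, ∃ f : Isom d, ∀ γ : Γ, ρ γ = f * inclusionRep Γ γ * f⁻¹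

/-- The vector of `ℝ^{5,1}` with first four coordinates `a ∘ σ`, followed by `s` and `t`. -/
def permVec (a : Fin 4 → ℝ) (σ : Equiv.Perm (Fin 4)) (s t : ℝ) : Vec 5 :=
  ![a (σ 0), a (σ 1), a (σ 2), a (σ 3), s, t]

/-- The vectors obtained by permuting the first four coordinates of `(±1, 0, 0, 0, 1, 1)`. -/
def normals₁ : Set (Vec 5) :=
  {v | ∃ ε : ℝ, (ε = 1 ∨ ε = -1) ∧ ∃ σ, v = permVec ![ε, 0, 0, 0] σ 1 1}

/-- The vectors obtained by permuting the first four coordinates of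
`(±1, 0, 0, 0, -1/2, 1/2)`. -/
def normals₂ : Set (Vec 5) :=
  {v | ∃ ε : ℝ, (ε = 1 ∨ ε = -1) ∧ ∃ σ, v = permVec ![ε, 0, 0, 0] σ (-1 / 2) (1 / 2)}

/-- The vectors obtained by permuting the first four coordinates of
`(±1, ±1, ±1, 0, 1/2, 3/2)`. -/
def normals₃ : Set (Vec 5) :=
  {v | ∃ ε₁ ε₂ ε₃ : ℝ, (ε₁ = 1 ∨ ε₁ = -1) ∧ (ε₂ = 1 ∨ ε₂ = -1) ∧ (ε₃ = 1 ∨ ε₃ = -1) ∧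
    ∃ σ, v = permVec ![ε₁, ε₂, ε₃, 0] σ (1 / 2) (3 / 2)}

/-- The 48 outer normal vectors of the right-angled polytope. -/
def normals : Set (Vec 5) := normals₁ ∪ normals₂ ∪ normals₃

theorem lform_permVec (a : Fin 4 → ℝ) (σ : Equiv.Perm (Fin 4)) (s t : ℝ) :
    lform (permVec a σ s t) (permVec a σ s t) = ∑ i, a i ^ 2 + s ^ 2 - t ^ 2 := by
  rw [← Equiv.sum_comp σ]
  simp [lform, permVec, Fin.sum_univ_succ, Fin.last]
  ring

/-- The normal vectors are unit space-like vectors, so each of them has a reflection. -/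
theorem normals_unit {v : Vec 5} (hv : v ∈ normals) : lform v v = 1 := by
  rcases hv with (⟨ε, h, σ, rfl⟩ | ⟨ε, h, σ, rfl⟩) | ⟨ε₁, ε₂, ε₃, h₁, h₂, h₃, σ, rfl⟩
  · rw [lform_permVec]
    rcases h with rfl | rfl <;> norm_num [Fin.sum_univ_succ]
  · rw [lform_permVec]
    rcases h with rfl | rfl <;> norm_num [Fin.sum_univ_succ]
  · rw [lform_permVec]
    rcases h₁ with rfl | rfl <;> rcases h₂ with rfl | rfl <;> rcases h₃ with rfl | rfl <;>
      norm_num [Fin.sum_univ_succ]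

end HypRACG

end

/-!
In the null basis `n₊ = (0, 0, 0, 0, 1, 1)`, `n₋ = (0, 0, 0, 0, -1/2, 1/2)` of the last two
coordinates, the normal vectors of the polytope are the vectors `α + n₊` and `α + n₋` (the *poles*),
where `α = ±eᵢ` runs over the facets of the tesseract `[-1, 1]⁴`, and the vectors `s + n₊ + n₋`,
where `s` runs over the midpoints of its edges. Orthogonal normal vectors belong to facets that
intersect (`not_disjoint_facet`), so that no two vectors of `F` are orthogonal.

The heart of the proof is infinitesimal rigidity (`IsInfinitesimalDeformation.exists_skew`): every
choice of velocities of the vectors in `normals \ F` that preserves their norms and right angles to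
first order comes from the Lie algebra of the Lorentz group. The normal vectors of the facets
through an ideal vertex form four mutually orthogonal pairs whose sums are multiples of the same
null vector, and at most one of these pairs meets `F`. Every remaining pair is a diagonal of an
octahedron formed by remaining vectors, which is infinitesimally rigid
(`firstVariation_diagonal_eq_zero`). Hence the inner product of the two vectors of a remaining pair
is preserved as well (`firstVariation_cusp`): tangent facets stay tangent to first order. With these
additional constraints, all inner products between six suitable poles, which form a basis, are
preserved. After subtracting an infinitesimal Lorentz transformation the six poles have velocity
zero. Linear algebra then propagates this to all poles (`velocity_pole_eq_zero`) and from there to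
the vectors of the edges (`velocity_edge_eq_zero`).

Infinitesimal rigidity implies local rigidity for configurations of vectors by the open mapping
theorem for strictly differentiable maps (`eventually_exists_lorentz`). Finally, a representation
close to the inclusion sends each generating reflection to an involution close to it, which is a
reflection whose normal vector depends continuously on the representation
(`exists_normal_of_involution`), and commuting reflections whose normal vectors are nearly
orthogonal have orthogonal normal vectors. So the representation is described by a configuration of
vectors with the prescribed right angles close to the original one, and the Lorentz transformation
between the two configurations conjugates the representation to the inclusion.
-/

namespace HypRACG

/-! ### The Lorentzian form and first variations -/

/-- The Lorentzian inner product as a bilinear form. -/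
noncomputable def lformBilin (d : ℕ) : LinearMap.BilinForm ℝ (Vec d) :=
  LinearMap.mk₂ ℝ lform lform_add_left lform_smul_left
    (fun x y z => by rw [lform_comm, lform_add_left, lform_comm y, lform_comm z])
    (fun c x y => by rw [lform_comm, lform_smul_left, lform_comm y, smul_eq_mul])

theorem lform_add_right {d : ℕ} (x y z : Vec d) : lform x (y + z) = lform x y + lform x z :=
  map_add (lformBilin d x) y z

theorem lform_smul_right {d : ℕ} (c : ℝ) (x y : Vec d) : lform x (c • y) = c * lform x y :=
  map_smul (lformBilin d x) c y

theorem lform_sub_left {d : ℕ} (x y z : Vec d) : lform (x - y) z = lform x z - lform y z :=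
  LinearMap.map_sub₂ (lformBilin d) x y z

theorem lform_sub_right {d : ℕ} (x y z : Vec d) : lform x (y - z) = lform x y - lform x z :=
  map_sub (lformBilin d x) y z

theorem lform_zero_left {d : ℕ} (x : Vec d) : lform 0 x = 0 :=
  LinearMap.map_zero₂ (lformBilin d) x

theorem lform_zero_right {d : ℕ} (x : Vec d) : lform x 0 = 0 := map_zero (lformBilin d x)

/-- The derivative of `⟨u, v⟩` when each vector `x` moves with velocity `w x`. -/
def firstVariation {d : ℕ} (w : Vec d → Vec d) (u v : Vec d) : ℝ :=
  lform (w u) v + lform u (w v)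

theorem firstVariation_comm {d : ℕ} (w : Vec d → Vec d) (u v : Vec d) :
    firstVariation w u v = firstVariation w v u := by
  rw [firstVariation, firstVariation, lform_comm u, lform_comm (w u), add_comm]

/-- If the inner products between the pairs `a, a'` and `b, b'` are infinitesimally preserved, and
the sums of both pairs are multiples of `n`, then the velocities of the sums satisfy a linear
relation. -/
theorem lform_velocity_pair {d : ℕ} {w : Vec d → Vec d} {a a' b b' n : Vec d} {k l : ℝ}
    (ha : a + a' = k • n) (hb : b + b' = l • n) (h₁ : firstVariation w a b = 0)
    (h₂ : firstVariation w a b' = 0) (h₃ : firstVariation w a' b = 0)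
    (h₄ : firstVariation w a' b' = 0) :
    l * lform (w a + w a') n + k * lform (w b + w b') n = 0 := by
  rw [← lform_smul_right, ← lform_smul_right, ← ha, ← hb]
  unfold firstVariation at *
  simp only [lform_add_left, lform_add_right]
  linarith [lform_comm a (w b), lform_comm a (w b'), lform_comm a' (w b), lform_comm a' (w b')]

/-- An octahedron whose three diagonals pass through a common point is infinitesimally rigid: if
the inner products along its edges are infinitesimally preserved, then so are those along its
diagonals. -/
theorem firstVariation_diagonal_eq_zero {d : ℕ} {w : Vec d → Vec d} {a a' b b' c c' n : Vec d}
    {k l m : ℝ} (ha : a + a' = k • n) (hb : b + b' = l • n) (hc : c + c' = m • n)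
    (hl : l ≠ 0) (hm : m ≠ 0)
    (haa : firstVariation w a a = 0) (haa' : firstVariation w a' a' = 0)
    (ab : firstVariation w a b = 0) (ab' : firstVariation w a b' = 0)
    (a'b : firstVariation w a' b = 0) (a'b' : firstVariation w a' b' = 0)
    (ac : firstVariation w a c = 0) (ac' : firstVariation w a c' = 0)
    (a'c : firstVariation w a' c = 0) (a'c' : firstVariation w a' c' = 0)
    (bc : firstVariation w b c = 0) (bc' : firstVariation w b c' = 0)
    (b'c : firstVariation w b' c = 0) (b'c' : firstVariation w b' c' = 0) :
    firstVariation w a a' = 0 := by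
  have h₁ := lform_velocity_pair ha hb ab ab' a'b a'b'
  have h₂ := lform_velocity_pair ha hc ac ac' a'c a'c'
  have h₃ := lform_velocity_pair hb hc bc bc' b'c b'c'
  -- pairwise sums of three numbers vanish, hence so does each of them
  have h₄ : l * m * lform (w a + w a') n = 0 := by
    linear_combination (m * h₁ + l * h₂ - k * h₃) / 2
  have h₅ : lform (w a + w a') n = 0 := (mul_eq_zero.mp h₄).resolve_left (mul_ne_zero hl hm)
  have h₆ : lform (w a + w a') (a + a') = 0 := by rw [ha, lform_smul_right, h₅, mul_zero]
  unfold firstVariation at *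
  simp only [lform_add_left, lform_add_right] at h₆
  linarith [lform_comm a (w a), lform_comm a' (w a'), lform_comm a (w a')]

/-! ### Coordinates adapted to the polytope -/

/-- The vector `x + a n₊ + b n₋`, where `x` lies in the span of the first four basis vectors and
`n₊ = (0, 0, 0, 0, 1, 1)` and `n₋ = (0, 0, 0, 0, -1/2, 1/2)` are null vectors with
`⟨n₊, n₋⟩ = -1`. -/
noncomputable def nvec (x : Fin 4 → ℝ) (a b : ℝ) : Vec 5 :=
  ![x 0, x 1, x 2, x 3, a - b / 2, a + b / 2]

theorem lform_nvec (x y : Fin 4 → ℝ) (a b c d : ℝ) :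
    lform (nvec x a b) (nvec y c d) = ∑ i, x i * y i - a * d - b * c := by
  simp [lform, nvec, Fin.sum_univ_succ, Fin.last]
  ring

theorem exists_eq_nvec (v : Vec 5) : ∃ x a b, v = nvec x a b := by
  refine ⟨fun i => v i.castSucc.castSucc, (v 4 + v 5) / 2, v 5 - v 4, ?_⟩
  ext i
  fin_cases i <;> simp [nvec] <;> ring

theorem nvec_add (x y : Fin 4 → ℝ) (a b c d : ℝ) :
    nvec x a b + nvec y c d = nvec (x + y) (a + c) (b + d) := by
  ext i
  fin_cases i <;> simp [nvec] <;> ring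

theorem smul_nvec (k : ℝ) (x : Fin 4 → ℝ) (a b : ℝ) :
    k • nvec x a b = nvec (k • x) (k * a) (k * b) := by
  ext i
  fin_cases i <;> simp [nvec] <;> ring

theorem nvec_zero : nvec 0 0 0 = 0 := by
  ext i
  fin_cases i <;> simp [nvec]

/-- The vector `ε eᵢ + c n₊ + (1 - c) n₋`. For `c = 1` and `c = 0` and `ε = ±1` these are the
normal vectors of the facets through the ideal points `n₊` and `n₋`; they correspond to the facets
of the tesseract. -/
noncomputable def pole (c : ℝ) (i : Fin 4) (ε : ℝ) : Vec 5 := nvec (Pi.single i ε) c (1 - c)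

theorem lform_nvec_pole (x : Fin 4 → ℝ) (a b c : ℝ) (i : Fin 4) (ε : ℝ) :
    lform (nvec x a b) (pole c i ε) = x i * ε - a * (1 - c) - b * c := by
  simp [pole, lform_nvec, Pi.single_apply]

theorem lform_pole_pole (c c' : ℝ) (i j : Fin 4) (ε δ : ℝ) :
    lform (pole c i ε) (pole c' j δ) =
      (if i = j then ε * δ else 0) - c * (1 - c') - (1 - c) * c' := by
  rw [pole, lform_nvec_pole, Pi.single_apply]
  simp [eq_comm]

/-- `s` has a zero coordinate at `k` and all its other coordinates are `±1`: it is the midpoint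
of an edge of the tesseract `[-1, 1]⁴` of direction `k`. -/
def IsEdge (s : Fin 4 → ℝ) (k : Fin 4) : Prop := s k = 0 ∧ ∀ i, i ≠ k → s i = 1 ∨ s i = -1

theorem lform_nvec_edge (x s : Fin 4 → ℝ) (a b : ℝ) :
    lform (nvec x a b) (nvec s 1 1) = ∑ i, x i * s i - a - b := by
  rw [lform_nvec, mul_one, mul_one]

theorem permVec_single (ε : ℝ) (σ : Equiv.Perm (Fin 4)) (a b : ℝ) :
    permVec ![ε, 0, 0, 0] σ (a - b / 2) (a + b / 2) = nvec (Pi.single (σ.symm 0) ε) a b := by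
  have h : ∀ i, (![ε, 0, 0, 0] : Fin 4 → ℝ) (σ i) =
      (Pi.single (σ.symm 0) ε : Fin 4 → ℝ) i := fun i => by
    have : (![ε, 0, 0, 0] : Fin 4 → ℝ) = Pi.single 0 ε := by ext j; fin_cases j <;> rfl
    simp only [this, Pi.single_apply, Equiv.eq_symm_apply]
  simp only [permVec, nvec, h]

/-- The normal vectors correspond to two copies of the set of facets of the tesseract and to the
set of its edges. -/
theorem mem_normals_iff (v : Vec 5) : v ∈ normals ↔
    (∃ c i ε, (c = 0 ∨ c = 1) ∧ (ε = 1 ∨ ε = -1) ∧ v = pole c i ε) ∨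
      ∃ s k, IsEdge s k ∧ v = nvec s 1 1 := by
  constructor
  · rintro ((⟨ε, h, σ, rfl⟩ | ⟨ε, h, σ, rfl⟩) | ⟨ε₁, ε₂, ε₃, h₁, h₂, h₃, σ, rfl⟩)
    · refine Or.inl ⟨1, σ.symm 0, ε, Or.inr rfl, h, ?_⟩
      rw [pole, ← permVec_single]
      norm_num
    · refine Or.inl ⟨0, σ.symm 0, ε, Or.inl rfl, h, ?_⟩
      rw [pole, ← permVec_single]
      norm_num
    · refine Or.inr ⟨fun i => (![ε₁, ε₂, ε₃, 0] : Fin 4 → ℝ) (σ i), σ.symm 3,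
        ⟨by simp, fun i hi => ?_⟩, ?_⟩
      · have : σ i ≠ 3 := fun h => hi (by rw [← h, Equiv.symm_apply_apply])
        beta_reduce
        generalize σ i = j at this ⊢
        fin_cases j <;> simp_all
      · simp only [permVec, nvec]
        norm_num
  · rintro (⟨c, i, ε, hc, hε, rfl⟩ | ⟨s, k, hs, rfl⟩)
    · have key : ∀ a b : ℝ, nvec (Pi.single i ε) a b =
          permVec ![ε, 0, 0, 0] (Equiv.swap i 0) (a - b / 2) (a + b / 2) := fun a b => by
        rw [permVec_single]; simp
      rcases hc with rfl | rfl
      · refine Or.inl (Or.inr ⟨ε, hε, Equiv.swap i 0, ?_⟩)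
        rw [pole, key]; norm_num
      · refine Or.inl (Or.inl ⟨ε, hε, Equiv.swap i 0, ?_⟩)
        rw [pole, key]; norm_num
    · have hne : ∀ j : Fin 4, j ≠ 3 → s (Equiv.swap k 3 j) = 1 ∨ s (Equiv.swap k 3 j) = -1 :=
        fun j hj => hs.2 _ fun h => hj (by
          rwa [Equiv.swap_apply_eq_iff, Equiv.swap_apply_left] at h)
      refine Or.inr ⟨s (Equiv.swap k 3 0), s (Equiv.swap k 3 1), s (Equiv.swap k 3 2),
        hne _ (by decide), hne _ (by decide), hne _ (by decide), Equiv.swap k 3, ?_⟩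
      have h : ∀ i, (![s (Equiv.swap k 3 0), s (Equiv.swap k 3 1), s (Equiv.swap k 3 2), 0] :
          Fin 4 → ℝ) (Equiv.swap k 3 i) = s i := fun i => by
        have : (![s (Equiv.swap k 3 0), s (Equiv.swap k 3 1), s (Equiv.swap k 3 2), 0] :
          Fin 4 → ℝ) = fun j => s (Equiv.swap k 3 j) := by
          ext j; fin_cases j <;> simp [hs.1]
        rw [this]; simp
      simp only [permVec, nvec, h]
      norm_num

theorem pole_mem {c : ℝ} (hc : c = 0 ∨ c = 1) (i : Fin 4) {ε : ℝ} (hε : ε = 1 ∨ ε = -1) :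
    pole c i ε ∈ normals := (mem_normals_iff _).2 (Or.inl ⟨c, i, ε, hc, hε, rfl⟩)

theorem edge_mem {s : Fin 4 → ℝ} {k : Fin 4} (hs : IsEdge s k) : nvec s 1 1 ∈ normals :=
  (mem_normals_iff _).2 (Or.inr ⟨s, k, hs, rfl⟩)

theorem finite_normals : normals.Finite := by
  refine (Set.Finite.pi' (ι := Fin 6) fun _ =>
    Set.toFinite ({0, 1, -1, 1 / 2, -1 / 2, 3 / 2} : Set ℝ)).subset fun v hv j => ?_
  have h3 : ∀ (ε₁ ε₂ ε₃ : ℝ) (i : Fin 4), (ε₁ = 1 ∨ ε₁ = -1 ∨ ε₁ = 0) →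
      (ε₂ = 1 ∨ ε₂ = -1 ∨ ε₂ = 0) → (ε₃ = 1 ∨ ε₃ = -1 ∨ ε₃ = 0) →
      (![ε₁, ε₂, ε₃, 0] : Fin 4 → ℝ) i ∈ ({0, 1, -1, 1 / 2, -1 / 2, 3 / 2} : Set ℝ) := by
    intro ε₁ ε₂ ε₃ i h₁ h₂ h₃
    simp only [Set.mem_insert_iff, Set.mem_singleton_iff]
    fin_cases i <;> simp <;> tauto
  rcases hv with (⟨ε, h, σ, rfl⟩ | ⟨ε, h, σ, rfl⟩) | ⟨ε₁, ε₂, ε₃, h₁, h₂, h₃, σ, rfl⟩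
  · fin_cases j
    all_goals first | exact h3 _ _ _ _ (by tauto) (by tauto) (by tauto) | simp [permVec]
  · fin_cases j
    all_goals first | exact h3 _ _ _ _ (by tauto) (by tauto) (by tauto) | simp [permVec]
  · fin_cases j
    all_goals first | exact h3 _ _ _ _ (by tauto) (by tauto) (by tauto) | simp [permVec]

theorem IsEdge.mul_le_one {s t : Fin 4 → ℝ} {k l : Fin 4} (hs : IsEdge s k) (ht : IsEdge t l)
    (i : Fin 4) : s i * t i ≤ 1 := by
  have key : ∀ {s : Fin 4 → ℝ} {k}, IsEdge s k → s i = 0 ∨ s i = 1 ∨ s i = -1 := by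
    intro s k hs
    by_cases h : i = k
    · exact Or.inl (h ▸ hs.1)
    · exact Or.inr (hs.2 i h)
  rcases key hs with h | h | h <;> rcases key ht with h' | h' | h' <;> rw [h, h'] <;> norm_num

/-- The dihedral angles of the polytope are not obtuse. -/
theorem lform_normals_nonpos {u v : Vec 5} (hu : u ∈ normals) (hv : v ∈ normals) (huv : u ≠ v) :
    lform u v ≤ 0 := by
  have pe : ∀ (c : ℝ) (i : Fin 4) (ε : ℝ) (s : Fin 4 → ℝ) (k : Fin 4), (ε = 1 ∨ ε = -1) →
      IsEdge s k → lform (nvec s 1 1) (pole c i ε) ≤ 0 := by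
    intro c i ε s k hε hs
    rw [lform_nvec_pole]
    by_cases hik : i = k
    · rw [hik, hs.1]; linarith
    · rcases hs.2 i hik with h | h <;> rcases hε with rfl | rfl <;> rw [h] <;> linarith
  rcases (mem_normals_iff u).1 hu with ⟨c, i, ε, hc, hε, rfl⟩ | ⟨s, k, hs, rfl⟩ <;>
    rcases (mem_normals_iff v).1 hv with ⟨c', i', ε', hc', hε', rfl⟩ | ⟨t, l, ht, rfl⟩
  · rw [lform_pole_pole]
    by_cases hi : i = i'
    · subst hi
      rcases hc with rfl | rfl <;> rcases hc' with rfl | rfl <;> rcases hε with rfl | rfl <;>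
        rcases hε' with rfl | rfl <;> first | exact absurd rfl huv | norm_num
    · rw [if_neg hi]
      rcases hc with rfl | rfl <;> rcases hc' with rfl | rfl <;> norm_num
  · rw [lform_comm]; exact pe _ _ _ _ _ hε ht
  · exact pe _ _ _ _ _ hε' hs
  · rw [lform_nvec_edge]
    -- two of the four products of coordinates are not positive, and all are at most `1`
    have key : ∀ (p : Fin 4 → ℝ) (i j : Fin 4), (∀ m, p m ≤ 1) → i ≠ j → p i ≤ 0 → p j ≤ 0 →
        ∑ m, p m ≤ 2 := by
      intro p i j hp hij hi hj
      have h0 := hp 0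
      have h1 := hp 1
      have h2 := hp 2
      have h3 := hp 3
      rw [Fin.sum_univ_four]
      fin_cases i <;> fin_cases j <;> simp at * <;> linarith
    have hk : s k * t k = 0 := by rw [hs.1, zero_mul]
    have hl : s l * t l = 0 := by rw [ht.1, mul_zero]
    suffices h : ∑ m, s m * t m ≤ 2 by linarith
    by_cases hkl : k = l
    · subst hkl
      obtain ⟨i, hi⟩ : ∃ i, s i ≠ t i := by
        by_contra! h
        exact huv (by rw [funext h])
      have hik : i ≠ k := fun h => hi (by rw [h, hs.1, ht.1])
      have hm : s i * t i ≤ 0 := by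
        rcases hs.2 i hik with h | h <;> rcases ht.2 i hik with h' | h' <;>
          first | exact absurd (h.trans h'.symm) hi | (rw [h, h']; norm_num)
      exact key _ i k (hs.mul_le_one ht) hik hm hk.le
    · exact key _ k l (hs.mul_le_one ht) hkl hk.le hl.le

/-- Facets with orthogonal normal vectors intersect: they share the orthogonal projection of the
centre `n₊ + n₋` of the polytope to the intersection of their hyperplanes. -/
theorem not_disjoint_facet {v w : Vec 5} (hv : v ∈ normals) (hw : w ∈ normals)
    (hvw : lform v w = 0) : ¬ Disjoint (facet normals v) (facet normals w) := by
  have hc : ∀ u ∈ normals, lform (nvec 0 1 1) u < 0 := by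
    intro u hu
    rcases (mem_normals_iff u).1 hu with ⟨c, i, ε, hc, hε, rfl⟩ | ⟨s, k, hs, rfl⟩
    · rw [lform_nvec_pole]; simp
    · rw [lform_nvec_edge]; norm_num
  set c := nvec 0 1 1 with hcdef
  set x := c - lform c v • v - lform c w • w with hx
  have hxu : ∀ u, lform x u = lform c u - lform c v * lform v u - lform c w * lform w u := by
    intro u; rw [hx, lform_sub_left, lform_sub_left, lform_smul_left, lform_smul_left]
  have hxv : lform x v = 0 := by rw [hxu, normals_unit hv, lform_comm w, hvw]; ring
  have hxw : lform x w = 0 := by rw [hxu, normals_unit hw, hvw]; ring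
  have hxle : ∀ u ∈ normals, lform x u ≤ 0 := by
    intro u hu
    by_cases huv : u = v
    · rw [huv, hxv]
    by_cases huw : u = w
    · rw [huw, hxw]
    rw [hxu]
    nlinarith [hc u hu, hc v hv, hc w hw, lform_normals_nonpos hv hu (Ne.symm huv),
      lform_normals_nonpos hw hu (Ne.symm huw)]
  have hcc : lform c c = -2 := by rw [hcdef, lform_nvec]; simp; norm_num
  have hxx : lform x x = -2 - lform c v ^ 2 - lform c w ^ 2 := by
    rw [hxu, lform_comm v x, lform_comm w x, hxv, hxw, lform_comm c x, hxu, hcc, lform_comm v c,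
      lform_comm w c]
    ring
  have hneg : 0 < - lform x x := by
    rw [hxx]; nlinarith [sq_nonneg (lform c v), sq_nonneg (lform c w)]
  have hlast : 0 < x (Fin.last 5) := by
    have hlv : 0 < v (Fin.last 5) := by
      rcases (mem_normals_iff v).1 hv with ⟨a, i, ε, ha, hε, rfl⟩ | ⟨s, k, hs, rfl⟩
      · rcases ha with rfl | rfl <;> simp [pole, nvec, Fin.last]
      · simp [nvec, Fin.last]; norm_num
    have hlw : 0 < w (Fin.last 5) := by
      rcases (mem_normals_iff w).1 hw with ⟨a, i, ε, ha, hε, rfl⟩ | ⟨s, k, hs, rfl⟩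
      · rcases ha with rfl | rfl <;> simp [pole, nvec, Fin.last]
      · simp [nvec, Fin.last]; norm_num
    have hlc : 0 < c (Fin.last 5) := by simp [hcdef, nvec, Fin.last]; norm_num
    simp only [hx, Pi.sub_apply, Pi.smul_apply, smul_eq_mul]
    nlinarith [mul_pos (neg_pos.2 (hc v hv)) hlv, mul_pos (neg_pos.2 (hc w hw)) hlw]
  have hr : 0 < (√(- lform x x))⁻¹ := inv_pos.2 (Real.sqrt_pos.2 hneg)
  set r := (√(- lform x x))⁻¹ with hrdef
  have hy : r • x ∈ hyperboloid 5 := by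
    refine ⟨?_, by simpa using mul_pos hr hlast⟩
    have h2 : √(- lform x x) ^ 2 = - lform x x := Real.sq_sqrt hneg.le
    have h3 : √(- lform x x) ≠ 0 := (Real.sqrt_pos.2 hneg).ne'
    rw [lform_smul_left, lform_smul_right, hrdef]
    field_simp
    linarith
  have hmem : ∀ z, lform x z = 0 → r • x ∈ facet normals z := fun z hz =>
    ⟨⟨hy, fun u hu => ⟨hy, by
      rw [lform_smul_left]; exact mul_nonpos_of_nonneg_of_nonpos hr.le (hxle u hu)⟩⟩,
      hy, by rw [lform_smul_left, hz, mul_zero]⟩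
  exact Set.not_disjoint_iff.2 ⟨r • x, hmem v hxv, hmem w hxw⟩

/-! ### Infinitesimal deformations of the cusps -/

/-- The velocities `w` of the vectors in `S` preserve, to first order, the norms of these vectors
and the right angles between them. -/
def IsInfinitesimalDeformation {d : ℕ} (S : Set (Vec d)) (w : Vec d → Vec d) : Prop :=
  ∀ u ∈ S, ∀ v ∈ S, (u = v ∨ lform u v = 0) → firstVariation w u v = 0

theorem IsInfinitesimalDeformation.lform_self {d : ℕ} {S : Set (Vec d)} {w : Vec d → Vec d}
    (hw : IsInfinitesimalDeformation S w) {v : Vec d} (hv : v ∈ S) : lform (w v) v = 0 := by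
  have := hw v hv v hv (Or.inl rfl)
  rw [firstVariation, lform_comm v] at this
  linarith

/-- No two vectors of `F` are orthogonal. -/
def OrthogonalFree {d : ℕ} (F : Set (Vec d)) : Prop := ∀ v ∈ F, ∀ w ∈ F, lform v w ≠ 0

/-- Among mutually orthogonal pairs of vectors, at most one contains a removed vector. -/
theorem OrthogonalFree.exists_forall_ne {d : ℕ} {ι : Type*} [Nonempty ι] {F : Set (Vec d)}
    (hF : OrthogonalFree F) {a a' : ι → Vec d}
    (horth : ∀ i j, i ≠ j →
      lform (a i) (a j) = 0 ∧ lform (a i) (a' j) = 0 ∧ lform (a' i) (a' j) = 0) :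
    ∃ j, ∀ l, l ≠ j → a l ∉ F ∧ a' l ∉ F := by
  by_cases h : ∃ j, a j ∈ F ∨ a' j ∈ F
  · obtain ⟨j, hj⟩ := h
    refine ⟨j, fun l hl => ?_⟩
    have h₁ := horth l j hl
    have h₂ := horth j l (Ne.symm hl)
    have h₃ : lform (a' l) (a j) = 0 := by rw [lform_comm, h₂.2.1]
    rcases hj with hj | hj
    · exact ⟨fun hl => hF _ hl _ hj h₁.1, fun hl => hF _ hl _ hj h₃⟩
    · exact ⟨fun hl => hF _ hl _ hj h₁.2.1, fun hl => hF _ hl _ hj h₁.2.2⟩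
  · push Not at h
    exact ⟨Classical.arbitrary ι, fun l _ => h l⟩

/-- Tangencies are infinitesimally preserved: the normal vectors of the facets through an ideal
vertex form four mutually orthogonal pairs, at most one of which meets `F`; a remaining pair is a
diagonal of an octahedron formed by remaining vectors. -/
theorem firstVariation_cusp {F : Set (Vec 5)} (hF : OrthogonalFree F) {w : Vec 5 → Vec 5}
    (hw : IsInfinitesimalDeformation (normals \ F) w) {a a' : Fin 4 → Vec 5} {n : Vec 5}
    {k : Fin 4 → ℝ} (ha : ∀ i, a i ∈ normals) (ha' : ∀ i, a' i ∈ normals)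
    (hsum : ∀ i, a i + a' i = k i • n) (hk : ∀ i, k i ≠ 0)
    (horth : ∀ i j, i ≠ j →
      lform (a i) (a j) = 0 ∧ lform (a i) (a' j) = 0 ∧ lform (a' i) (a' j) = 0)
    (i : Fin 4) (hi : a i ∉ F) (hi' : a' i ∉ F) : firstVariation w (a i) (a' i) = 0 := by
  obtain ⟨j, hj⟩ := hF.exists_forall_ne horth
  obtain ⟨p, q, hpq, hpi, hqi, hpj, hqj⟩ :
      ∃ p q : Fin 4, p ≠ q ∧ p ≠ i ∧ q ≠ i ∧ p ≠ j ∧ q ≠ j := by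
    clear hi hi' hj
    revert i j; decide
  obtain ⟨hp, hp'⟩ := hj p hpj
  obtain ⟨hq, hq'⟩ := hj q hqj
  have hsymm : ∀ i j, i ≠ j → lform (a' i) (a j) = 0 := fun i j hij => by
    rw [lform_comm]; exact (horth j i hij.symm).2.1
  have H : ∀ {u v}, u ∈ normals → u ∉ F → v ∈ normals → v ∉ F → u = v ∨ lform u v = 0 →
      firstVariation w u v = 0 := fun hu hu' hv hv' h => hw _ ⟨hu, hu'⟩ _ ⟨hv, hv'⟩ h
  exact firstVariation_diagonal_eq_zero (hsum i) (hsum p) (hsum q) (hk p) (hk q)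
    (H (ha i) hi (ha i) hi (Or.inl rfl)) (H (ha' i) hi' (ha' i) hi' (Or.inl rfl))
    (H (ha i) hi (ha p) hp (Or.inr (horth i p hpi.symm).1))
    (H (ha i) hi (ha' p) hp' (Or.inr (horth i p hpi.symm).2.1))
    (H (ha' i) hi' (ha p) hp (Or.inr (hsymm i p hpi.symm)))
    (H (ha' i) hi' (ha' p) hp' (Or.inr (horth i p hpi.symm).2.2))
    (H (ha i) hi (ha q) hq (Or.inr (horth i q hqi.symm).1))
    (H (ha i) hi (ha' q) hq' (Or.inr (horth i q hqi.symm).2.1))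
    (H (ha' i) hi' (ha q) hq (Or.inr (hsymm i q hqi.symm)))
    (H (ha' i) hi' (ha' q) hq' (Or.inr (horth i q hqi.symm).2.2))
    (H (ha p) hp (ha q) hq (Or.inr (horth p q hpq).1))
    (H (ha p) hp (ha' q) hq' (Or.inr (horth p q hpq).2.1))
    (H (ha' p) hp' (ha q) hq (Or.inr (hsymm p q hpq)))
    (H (ha' p) hp' (ha' q) hq' (Or.inr (horth p q hpq).2.2))

theorem pole_orthogonal {c : ℝ} (hc : c = 0 ∨ c = 1) {i j : Fin 4} (hij : i ≠ j) (ε δ : ℝ) :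
    lform (pole c i ε) (pole c j δ) = 0 := by
  rw [lform_pole_pole, if_neg hij]
  rcases hc with rfl | rfl <;> ring

theorem pole_pole_orthogonal {c c' : ℝ} (hcc : c + c' = 1) (hc : c = 0 ∨ c = 1) (i : Fin 4)
    {ε : ℝ} (hε : ε = 1 ∨ ε = -1) : lform (pole c i ε) (pole c' i ε) = 0 := by
  obtain rfl : c' = 1 - c := by linarith
  rw [lform_pole_pole, if_pos rfl]
  rcases hc with rfl | rfl <;> rcases hε with rfl | rfl <;> ring

theorem pole_edge_orthogonal (c : ℝ) {s : Fin 4 → ℝ} {i : Fin 4} (hs : s i = 1 ∨ s i = -1) :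
    lform (pole c i (s i)) (nvec s 1 1) = 0 := by
  rw [lform_comm, lform_nvec_pole]
  rcases hs with h | h <;> rw [h] <;> ring

/-- Tangency is preserved at the ideal vertices `n₊` and `n₋`, whose pairs are opposite poles. -/
theorem firstVariation_pole_opposite {F : Set (Vec 5)} (hF : OrthogonalFree F)
    {w : Vec 5 → Vec 5} (hw : IsInfinitesimalDeformation (normals \ F) w) {c : ℝ}
    (hc : c = 0 ∨ c = 1) (i : Fin 4) (h : pole c i 1 ∈ normals \ F)
    (h' : pole c i (-1) ∈ normals \ F) : firstVariation w (pole c i 1) (pole c i (-1)) = 0 := by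
  refine firstVariation_cusp hF hw (a := fun i => pole c i 1) (a' := fun i => pole c i (-1))
    (n := nvec 0 c (1 - c)) (k := fun _ => 2) (fun i => pole_mem hc i (Or.inl rfl))
    (fun i => pole_mem hc i (Or.inr rfl)) (fun i => ?_) (fun _ => two_ne_zero)
    (fun i j hij => ⟨pole_orthogonal hc hij _ _, pole_orthogonal hc hij _ _,
      pole_orthogonal hc hij _ _⟩) i h.2 h'.2
  simp only [pole]
  rw [nvec_add, smul_nvec, ← Pi.single_add]
  norm_num [two_mul]

/-- Tangency is preserved at the ideal vertices that correspond to the vertices `x` of the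
tesseract. The pairs consist of a pole `xᵢ eᵢ + n±` and the edge through `x` of direction `i`. -/
theorem firstVariation_pole_edge_zero {F : Set (Vec 5)} (hF : OrthogonalFree F)
    {w : Vec 5 → Vec 5} (hw : IsInfinitesimalDeformation (normals \ F) w) {c : ℝ}
    (hc : c = 0 ∨ c = 1) {k : Fin 4} {ε : ℝ} (hε : ε = 1 ∨ ε = -1) {s : Fin 4 → ℝ}
    (hs : IsEdge s k) (h : pole c k ε ∈ normals \ F) (h' : nvec s 1 1 ∈ normals \ F) :
    firstVariation w (pole c k ε) (nvec s 1 1) = 0 := by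
  set x : Fin 4 → ℝ := Function.update s k ε with hx
  have hx1 : ∀ i, x i = 1 ∨ x i = -1 := by
    intro i
    by_cases hik : i = k
    · subst hik; simpa [hx] using hε
    · simpa [hx, hik] using hs.2 i hik
  have hxs : Function.update x k 0 = s := by
    rw [hx, Function.update_idem, ← hs.1, Function.update_eq_self]
  have hxk : x k = ε := by simp [hx]
  have hedge : ∀ i, IsEdge (Function.update x i 0) i := fun i =>
    ⟨by simp, fun j hj => by simpa [hj] using hx1 j⟩
  have := firstVariation_cusp hF hw (a := fun i => pole c i (x i))
    (a' := fun i => nvec (Function.update x i 0) 1 1) (n := nvec x (c + 1) (1 - c + 1))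
    (k := fun _ => 1) (fun i => pole_mem hc i (hx1 i)) (fun i => edge_mem (hedge i)) ?_
    (fun _ => one_ne_zero) ?_ k (by rw [hxk]; exact h.2)
    (by rw [hxs]; exact h'.2)
  · simpa only [hxk, hxs] using this
  · intro i
    rw [one_smul, pole, nvec_add]
    congr 1
    ext j
    by_cases hj : j = i
    · subst hj; simp
    · simp [hj]
  · intro i j hij
    refine ⟨pole_orthogonal hc hij _ _, ?_, ?_⟩
    · have h2 : x i = Function.update x j 0 i := by simp [hij]
      rw [h2]
      exact pole_edge_orthogonal c (by rw [← h2]; exact hx1 i)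
    · rw [lform_nvec_edge]
      have h2 : ∀ m, Function.update x i 0 m * Function.update x j 0 m =
          1 - (if m = i then 1 else 0) - (if m = j then 1 else 0) := by
        intro m
        by_cases hmi : m = i
        · subst hmi; simp [hij]
        · by_cases hmj : m = j
          · subst hmj; simp [hmi]
          · rcases hx1 m with h | h <;> simp [hmi, hmj, h]
      simp only [h2, Finset.sum_sub_distrib, Finset.sum_ite_eq', Finset.mem_univ, if_true]
      norm_num

/-- Tangency is preserved at the ideal vertices that correspond to the two-dimensional faces of the
tesseract. If such a face is the intersection of the facets `α` and `β`, then two pairs are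
`α + n±, β + n∓`, and the other two are the pairs of opposite edges of the face. -/
theorem firstVariation_pole_pole {F : Set (Vec 5)} (hF : OrthogonalFree F)
    {w : Vec 5 → Vec 5} (hw : IsInfinitesimalDeformation (normals \ F) w) {c c' : ℝ}
    (hcc : c + c' = 1) (hc : c = 0 ∨ c = 1) {i j : Fin 4} (hij : i ≠ j) {ε δ : ℝ}
    (hε : ε = 1 ∨ ε = -1) (hδ : δ = 1 ∨ δ = -1)
    (h : pole c i ε ∈ normals \ F) (h' : pole c' j δ ∈ normals \ F) :
    firstVariation w (pole c i ε) (pole c' j δ) = 0 := by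
  obtain rfl : c' = 1 - c := by linarith
  have hc' : 1 - c = 0 ∨ 1 - c = 1 := by rcases hc with rfl | rfl <;> norm_num
  obtain ⟨r, t, hrt, hri, hrj, hti, htj, hall⟩ : ∃ r t : Fin 4, r ≠ t ∧ r ≠ i ∧ r ≠ j ∧ t ≠ i ∧
      t ≠ j ∧ ∀ m, m = i ∨ m = j ∨ m = r ∨ m = t := by
    clear h h'
    revert i j; decide
  let e : Fin 4 → ℝ → Fin 4 → ℝ := fun m γ => Pi.single i ε + Pi.single j δ + Pi.single m γ
  have he : ∀ m γ l, e m γ l =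
      (if l = i then ε else 0) + (if l = j then δ else 0) + if l = m then γ else 0 := by
    intro m γ l
    simp [e, Pi.single_apply]
  have her : ∀ γ, (γ = 1 ∨ γ = -1) → IsEdge (e r γ) t := by
    intro γ hγ
    refine ⟨by simp [he, hrt.symm, hti, htj], fun l hl => ?_⟩
    rcases hall l with rfl | rfl | rfl | rfl
    · simpa [he, hij, hri.symm] using hε
    · simpa [he, hij.symm, hrj.symm] using hδ
    · simpa [he, hri, hrj] using hγ
    · exact absurd rfl hl
  have het : ∀ γ, (γ = 1 ∨ γ = -1) → IsEdge (e t γ) r := by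
    intro γ hγ
    refine ⟨by simp [he, hrt, hri, hrj], fun l hl => ?_⟩
    rcases hall l with rfl | rfl | rfl | rfl
    · simpa [he, hij, hti.symm] using hε
    · simpa [he, hij.symm, htj.symm] using hδ
    · exact absurd rfl hl
    · simpa [he, hti, htj] using hγ
  have hpi : ∀ b m γ, m ≠ i → lform (pole b i ε) (nvec (e m γ) 1 1) = 0 := by
    intro b m γ hm
    have h1 : e m γ i = ε := by simp [he, hij, hm.symm]
    have := pole_edge_orthogonal b (s := e m γ) (i := i) (by rwa [h1])
    rwa [h1] at this
  have hpj : ∀ b m γ, m ≠ j → lform (pole b j δ) (nvec (e m γ) 1 1) = 0 := by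
    intro b m γ hm
    have h1 : e m γ j = δ := by simp [he, hij.symm, hm.symm]
    have := pole_edge_orthogonal b (s := e m γ) (i := j) (by rwa [h1])
    rwa [h1] at this
  have hee : ∀ γ γ', lform (nvec (e r γ) 1 1) (nvec (e t γ') 1 1) = 0 := by
    intro γ γ'
    have h1 : ∀ l, e r γ l * e t γ' l = (if l = i then 1 else 0) + if l = j then 1 else 0 := by
      intro l
      have h2 : ε * ε = 1 := by rcases hε with rfl | rfl <;> norm_num
      have h3 : δ * δ = 1 := by rcases hδ with rfl | rfl <;> norm_num
      rcases hall l with rfl | rfl | rfl | rfl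
      · simp [he, hij, hri.symm, hti.symm, h2]
      · simp [he, hij.symm, hrj.symm, htj.symm, h3]
      · simp [he, hri, hrj, hrt]
      · simp [he, hti, htj, hrt.symm]
    rw [lform_nvec_edge]
    simp only [h1, Finset.sum_add_distrib, Finset.sum_ite_eq', Finset.mem_univ, if_true]
    norm_num
  have hsumP : pole c i ε + pole (1 - c) j δ = nvec (Pi.single i ε + Pi.single j δ) 1 1 := by
    rw [pole, pole, nvec_add]; congr 1; ring
  have hsumE : ∀ m, nvec (e m 1) 1 1 + nvec (e m (-1)) 1 1 =
      (2 : ℝ) • nvec (Pi.single i ε + Pi.single j δ) 1 1 := by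
    intro m
    rw [nvec_add, smul_nvec]
    congr 1
    · simp only [e, Pi.single_neg]; module
    · norm_num
    · norm_num
  refine firstVariation_cusp hF hw
    (a := ![pole c i ε, pole c j δ, nvec (e r 1) 1 1, nvec (e t 1) 1 1])
    (a' := ![pole (1 - c) j δ, pole (1 - c) i ε, nvec (e r (-1)) 1 1, nvec (e t (-1)) 1 1])
    (n := nvec (Pi.single i ε + Pi.single j δ) 1 1) (k := ![1, 1, 2, 2]) ?_ ?_ ?_ ?_ ?_ 0 h.2 h'.2
  · intro m
    fin_cases m
    exacts [pole_mem hc _ hε, pole_mem hc _ hδ, edge_mem (her _ (Or.inl rfl)),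
      edge_mem (het _ (Or.inl rfl))]
  · intro m
    fin_cases m
    exacts [pole_mem hc' _ hδ, pole_mem hc' _ hε, edge_mem (her _ (Or.inr rfl)),
      edge_mem (het _ (Or.inr rfl))]
  · intro m
    fin_cases m
    · simpa using hsumP
    · simp only [Fin.mk_one, cons_val_one, cons_val_zero, one_smul]
      rw [pole, pole, nvec_add]
      exact congr (congr (congrArg nvec (add_comm _ _)) (by ring)) (by ring)
    · exact hsumE r
    · exact hsumE t
  · intro m
    fin_cases m <;> norm_num
  · have o1 := pole_pole_orthogonal (c := c) (c' := 1 - c) (by ring) hc i hε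
    have o2 := pole_pole_orthogonal (c := c) (c' := 1 - c) (by ring) hc j hδ
    have o3 := pole_orthogonal hc hij ε δ
    have o4 := pole_orthogonal hc' hij ε δ
    have p1 := fun b γ => hpi b r γ hri
    have p2 := fun b γ => hpi b t γ hti
    have p3 := fun b γ => hpj b r γ hrj
    have p4 := fun b γ => hpj b t γ htj
    intro m l hml
    fin_cases m <;> fin_cases l <;> first
      | exact absurd rfl hml
      | refine ⟨?_, ?_, ?_⟩ <;> simp only [Fin.zero_eta, Fin.mk_one, Fin.reduceFinMk, cons_val,
          o1, o2, o3, o4, p1, p2, p3, p4, hee] <;> rw [lform_comm] <;>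
          simp only [o3, o4, p1, p2, p3, p4, hee]

/-! ### Infinitesimal rigidity -/

/-- The inner products of all orthogonal and tangent pairs of poles are infinitesimally preserved.
The only remaining pairs are opposite poles at different cusps. -/
theorem firstVariation_poles {F : Set (Vec 5)} (hF : OrthogonalFree F)
    {w : Vec 5 → Vec 5} (hw : IsInfinitesimalDeformation (normals \ F) w) {c d : ℝ}
    (hc : c = 0 ∨ c = 1) (hd : d = 0 ∨ d = 1) {i j : Fin 4} {ε δ : ℝ} (hε : ε = 1 ∨ ε = -1)
    (hδ : δ = 1 ∨ δ = -1) (h : pole c i ε ∈ normals \ F) (h' : pole d j δ ∈ normals \ F)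
    (hne : c = d ∨ i ≠ j ∨ ε = δ) : firstVariation w (pole c i ε) (pole d j δ) = 0 := by
  by_cases hcd : c = d
  · subst hcd
    by_cases hij : i = j
    · subst hij
      rcases hε with rfl | rfl <;> rcases hδ with rfl | rfl
      · exact hw _ h _ h (Or.inl rfl)
      · exact firstVariation_pole_opposite hF hw hc i h h'
      · rw [firstVariation_comm]
        exact firstVariation_pole_opposite hF hw hc i h' h
      · exact hw _ h _ h (Or.inl rfl)
    · exact hw _ h _ h' (Or.inr (pole_orthogonal hc hij _ _))
  · have hcd1 : c + d = 1 := by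
      rcases hc with rfl | rfl <;> rcases hd with rfl | rfl <;>
        first | exact absurd rfl hcd | norm_num
    by_cases hij : i = j
    · subst hij
      obtain rfl : ε = δ := by tauto
      exact hw _ h _ h' (Or.inr (pole_pole_orthogonal hcd1 hc i hε))
    · exact firstVariation_pole_pole hF hw hcd1 hc hij hε hδ h h'

/-- The poles at one cusp that belong to `F` all have the same direction `j`. -/
theorem OrthogonalFree.exists_pole_notMem {F : Set (Vec 5)} (hF : OrthogonalFree F) {c : ℝ}
    (hc : c = 0 ∨ c = 1) :
    ∃ j, ∀ l, l ≠ j → ∀ ε, (ε = 1 ∨ ε = -1) → pole c l ε ∈ normals \ F := by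
  obtain ⟨j, hj⟩ := hF.exists_forall_ne (a := fun i => pole c i 1) (a' := fun i => pole c i (-1))
    fun i j hij => ⟨pole_orthogonal hc hij _ _, pole_orthogonal hc hij _ _,
      pole_orthogonal hc hij _ _⟩
  refine ⟨j, fun l hl ε hε => ⟨pole_mem hc l hε, ?_⟩⟩
  rcases hε with rfl | rfl
  exacts [(hj l hl).1, (hj l hl).2]

theorem OrthogonalFree.pole_notMem_or {F : Set (Vec 5)} (hF : OrthogonalFree F) (i : Fin 4)
    {ε : ℝ} (hε : ε = 1 ∨ ε = -1) : pole 1 i ε ∈ normals \ F ∨ pole 0 i ε ∈ normals \ F := by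
  by_cases h : pole 1 i ε ∈ F
  · exact Or.inr ⟨pole_mem (Or.inl rfl) i hε, fun h' =>
      hF _ h _ h' (pole_pole_orthogonal (by norm_num) (Or.inr rfl) i hε)⟩
  · exact Or.inl ⟨pole_mem (Or.inr rfl) i hε, h⟩

/-- A deformation that fixes the two poles of direction `p` at one cusp, the two poles of direction
`q` at the other cusp, and a pole in each of the two remaining directions, fixes all poles at the
first cusp. -/
theorem velocity_pole_eq_zero {F : Set (Vec 5)} (hF : OrthogonalFree F)
    {w : Vec 5 → Vec 5} (hw : IsInfinitesimalDeformation (normals \ F) w) {c c' : ℝ}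
    (hcc : c + c' = 1) (hc : c = 0 ∨ c = 1) {p q : Fin 4} (hpq : p ≠ q)
    (hp : ∀ ε, (ε = 1 ∨ ε = -1) → pole c p ε ∈ normals \ F ∧ w (pole c p ε) = 0)
    (hq : ∀ ε, (ε = 1 ∨ ε = -1) → pole c' q ε ∈ normals \ F ∧ w (pole c' q ε) = 0)
    (hr : ∀ i, i ≠ p → i ≠ q → ∃ d, (d = 0 ∨ d = 1) ∧ pole d i 1 ∈ normals \ F ∧
      w (pole d i 1) = 0) (i : Fin 4) {ε : ℝ} (hε : ε = 1 ∨ ε = -1)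
    (hi : pole c i ε ∈ normals \ F) : w (pole c i ε) = 0 := by
  have hc' : c' = 0 ∨ c' = 1 := by
    rcases hc with rfl | rfl
    exacts [Or.inr (by linarith), Or.inl (by linarith)]
  obtain ⟨x, a, b, hx⟩ := exists_eq_nvec (w (pole c i ε))
  have key : ∀ d j δ, (d = 0 ∨ d = 1) → (δ = 1 ∨ δ = -1) → pole d j δ ∈ normals \ F →
      w (pole d j δ) = 0 → (c = d ∨ i ≠ j ∨ ε = δ) → x j * δ - a * (1 - d) - b * d = 0 := by
    intro d j δ hd hδ hm h0 hne
    have := firstVariation_poles hF hw hc hd hε hδ hi hm hne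
    rw [firstVariation, h0, hx, lform_nvec_pole, lform_zero_right, add_zero] at this
    exact this
  have hself : x i * ε - a * (1 - c) - b * c = 0 := by
    rw [← lform_nvec_pole, ← hx]; exact hw.lform_self hi
  have hε0 : ε ≠ 0 := by rcases hε with rfl | rfl <;> norm_num
  have p1 := key c p 1 hc (Or.inl rfl) (hp 1 (Or.inl rfl)).1 (hp 1 (Or.inl rfl)).2 (Or.inl rfl)
  have p2 := key c p (-1) hc (Or.inr rfl) (hp _ (Or.inr rfl)).1 (hp _ (Or.inr rfl)).2 (Or.inl rfl)
  have hxp : x p = 0 := by linarith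
  have e1 : a * (1 - c) + b * c = 0 := by linarith
  have hxi : x i = 0 := by
    have : x i * ε = 0 := by linarith
    exact (mul_eq_zero.1 this).resolve_right hε0
  have e2 : x q = 0 ∧ a * (1 - c') + b * c' = 0 := by
    by_cases hqi : i = q
    · subst hqi
      have := key c' i ε hc' hε (hq ε hε).1 (hq ε hε).2 (Or.inr (Or.inr rfl))
      rw [hxi] at this
      exact ⟨hxi, by linarith⟩
    · have q1 := key c' q 1 hc' (Or.inl rfl) (hq 1 (Or.inl rfl)).1 (hq 1 (Or.inl rfl)).2
        (Or.inr (Or.inl hqi))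
      have q2 := key c' q (-1) hc' (Or.inr rfl) (hq _ (Or.inr rfl)).1 (hq _ (Or.inr rfl)).2
        (Or.inr (Or.inl hqi))
      constructor <;> linarith
  obtain ⟨hxq, e2⟩ := e2
  have hab : a = 0 ∧ b = 0 := by
    obtain rfl : c' = 1 - c := by linarith
    rcases hc with rfl | rfl <;> constructor <;> linarith
  obtain ⟨rfl, rfl⟩ := hab
  have hx0 : x = 0 := by
    ext j
    by_cases hji : i = j
    · rw [← hji, hxi]; rfl
    by_cases hjp : j = p
    · rw [hjp, hxp]; rfl
    by_cases hjq : j = q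
    · rw [hjq, hxq]; rfl
    obtain ⟨d, hd, hm, h0⟩ := hr j hjp hjq
    simpa using key d j 1 hd (Or.inl rfl) hm h0 (Or.inr (Or.inl hji))
  rw [hx, hx0, nvec_zero]

/-- A deformation that fixes all poles fixes the vectors that correspond to edges of the
tesseract. -/
theorem velocity_edge_eq_zero {F : Set (Vec 5)} (hF : OrthogonalFree F)
    {w : Vec 5 → Vec 5} (hw : IsInfinitesimalDeformation (normals \ F) w)
    (h0 : ∀ c, (c = 0 ∨ c = 1) → ∀ i ε, (ε = 1 ∨ ε = -1) → pole c i ε ∈ normals \ F →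
      w (pole c i ε) = 0) {s : Fin 4 → ℝ} {k : Fin 4} (hs : IsEdge s k)
    (h : nvec s 1 1 ∈ normals \ F) : w (nvec s 1 1) = 0 := by
  obtain ⟨x, a, b, hx⟩ := exists_eq_nvec (w (nvec s 1 1))
  have hself : ∑ i, x i * s i - a - b = 0 := by
    rw [← lform_nvec_edge, ← hx]; exact hw.lform_self h
  have key : ∀ c i ε, (c = 0 ∨ c = 1) → (ε = 1 ∨ ε = -1) → pole c i ε ∈ normals \ F →
      firstVariation w (pole c i ε) (nvec s 1 1) = 0 → x i * ε - a * (1 - c) - b * c = 0 := by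
    intro c i ε hc hε hm hf
    rw [firstVariation, h0 c hc i ε hε hm, hx, lform_comm (pole c i ε), lform_nvec_pole,
      lform_zero_left, zero_add] at hf
    exact hf
  have key1 : ∀ c i, (c = 0 ∨ c = 1) → i ≠ k → pole c i (s i) ∈ normals \ F →
      x i * s i - a * (1 - c) - b * c = 0 := fun c i hc hik hm =>
    key c i (s i) hc (hs.2 i hik) hm (hw _ hm _ h (Or.inr (pole_edge_orthogonal c (hs.2 i hik))))
  obtain ⟨j₁, hj₁⟩ := hF.exists_pole_notMem (c := 1) (Or.inr rfl)
  obtain ⟨j₀, hj₀⟩ := hF.exists_pole_notMem (c := 0) (Or.inl rfl)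
  -- a direction in which no pole with the sign given by `s` is removed
  obtain ⟨i, hik, hi₁, hi₀⟩ : ∃ i, i ≠ k ∧ i ≠ j₁ ∧ i ≠ j₀ := by
    clear hj₁ hj₀ hs h hself key key1
    revert k j₁ j₀; decide
  have hab : b = a := by
    have h1 := key1 1 i (Or.inr rfl) hik (hj₁ i hi₁ _ (hs.2 i hik))
    have h2 := key1 0 i (Or.inl rfl) hik (hj₀ i hi₀ _ (hs.2 i hik))
    linarith
  subst hab
  have hxs : ∀ i, x i * s i = b - if i = k then b else 0 := by
    intro i
    by_cases hik : i = k
    · rw [if_pos hik, hik, hs.1]; ring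
    · rw [if_neg hik]
      rcases hF.pole_notMem_or i (hs.2 i hik) with hm | hm
      · linarith [key1 1 i (Or.inr rfl) hik hm]
      · linarith [key1 0 i (Or.inl rfl) hik hm]
  have hb : b = 0 := by
    simp only [hxs, Finset.sum_sub_distrib, Finset.sum_const, Finset.card_univ, Fintype.card_fin,
      Finset.sum_ite_eq', Finset.mem_univ, if_true] at hself
    norm_num at hself
    linarith
  subst hb
  have hx0 : x = 0 := by
    ext i
    by_cases hik : i = k
    · subst hik
      rcases hF.pole_notMem_or i (Or.inl rfl : (1 : ℝ) = 1 ∨ (1 : ℝ) = -1) with hm | hm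
      · simpa using key 1 i 1 (Or.inr rfl) (Or.inl rfl) hm
          (firstVariation_pole_edge_zero hF hw (Or.inr rfl) (Or.inl rfl) hs hm h)
      · simpa using key 0 i 1 (Or.inl rfl) (Or.inl rfl) hm
          (firstVariation_pole_edge_zero hF hw (Or.inl rfl) (Or.inl rfl) hs hm h)
    · have h1 := hxs i
      rw [if_neg hik, sub_zero] at h1
      rcases mul_eq_zero.1 h1 with h2 | h2
      · exact h2
      · rcases hs.2 i hik with h3 | h3 <;> rw [h3] at h2 <;> norm_num at h2
  rw [hx, hx0, nvec_zero]

/-- Velocities of a basis that infinitesimally preserve all inner products come from an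
infinitesimal Lorentz transformation. -/
theorem exists_skew_of_basis {d : ℕ} {ι : Type*} (B : Module.Basis ι ℝ (Vec d))
    (w : Vec d → Vec d) (h : ∀ i j, firstVariation w (B i) (B j) = 0) :
    ∃ A : Vec d →ₗ[ℝ] Vec d, (∀ x y, lform (A x) y + lform x (A y) = 0) ∧
      ∀ i, w (B i) = A (B i) := by
  set A : Vec d →ₗ[ℝ] Vec d := B.constr ℝ fun i => w (B i) with hA
  have hAB : ∀ i, A (B i) = w (B i) := fun i => B.constr_basis ℝ _ i
  refine ⟨A, ?_, fun i => (hAB i).symm⟩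
  have h0 : (lformBilin d).compl₁₂ A LinearMap.id + (lformBilin d).compl₁₂ LinearMap.id A = 0 := by
    refine LinearMap.BilinForm.ext_basis B fun i j => ?_
    have := h i j
    rw [firstVariation, ← hAB, ← hAB] at this
    exact this
  intro x y
  exact LinearMap.congr_fun₂ h0 x y

/-- Six poles as in `velocity_pole_eq_zero` form a basis. -/
theorem linearIndependent_poles {p q r t : Fin 4} (hpq : p ≠ q) (hpr : p ≠ r) (hpt : p ≠ t)
    (hqr : q ≠ r) (hqt : q ≠ t) (hrt : r ≠ t) (c d : ℝ) :
    LinearIndependent ℝ ![pole 1 p 1, pole 1 p (-1), pole 0 q 1, pole 0 q (-1), pole c r 1,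
      pole d t 1] := by
  rw [Fintype.linearIndependent_iff]
  intro g hg
  have key : ∀ y, g 0 * lform y (pole 1 p 1) + g 1 * lform y (pole 1 p (-1)) +
      g 2 * lform y (pole 0 q 1) + g 3 * lform y (pole 0 q (-1)) + g 4 * lform y (pole c r 1) +
      g 5 * lform y (pole d t 1) = 0 := by
    intro y
    have := congrArg (lform y) hg
    rw [Fin.sum_univ_six, lform_zero_right] at this
    simp only [lform_add_right, lform_smul_right] at this
    exact this
  have coord : ∀ j, g 0 * (if p = j then 1 else 0) - g 1 * (if p = j then 1 else 0) +
      g 2 * (if q = j then 1 else 0) - g 3 * (if q = j then 1 else 0) +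
      g 4 * (if r = j then 1 else 0) + g 5 * (if t = j then 1 else 0) = 0 := by
    intro j
    have := key (nvec (Pi.single j 1) 0 0)
    simp only [lform_nvec_pole, Pi.single_apply] at this
    linarith
  have np := coord p
  have nq := coord q
  have nr := coord r
  have nt := coord t
  have h1 := key (nvec 0 0 1)
  have h2 := key (nvec 0 1 0)
  simp only [lform_nvec_pole, Pi.zero_apply] at h1 h2
  simp [hpq, hpr, hpt, hqr, hqt, hrt, hpq.symm, hpr.symm, hpt.symm, hqr.symm, hqt.symm,
    hrt.symm] at np nq nr nt
  rw [nr, nt] at h1 h2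
  intro i
  fin_cases i <;> simp <;> linarith

/-- Infinitesimal rigidity: the infinitesimal deformations of the remaining normal vectors come
from infinitesimal Lorentz transformations. -/
theorem IsInfinitesimalDeformation.exists_skew {F : Set (Vec 5)} (hF : OrthogonalFree F)
    {w : Vec 5 → Vec 5} (hw : IsInfinitesimalDeformation (normals \ F) w) :
    ∃ A : Vec 5 →ₗ[ℝ] Vec 5, (∀ x y, lform (A x) y + lform x (A y) = 0) ∧
      ∀ v ∈ normals \ F, w v = A v := by
  obtain ⟨j₁, hj₁⟩ := hF.exists_pole_notMem (c := 1) (Or.inr rfl)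
  obtain ⟨j₀, hj₀⟩ := hF.exists_pole_notMem (c := 0) (Or.inl rfl)
  obtain ⟨p, q, hp, hq, hpq⟩ : ∃ p q : Fin 4, p ≠ j₁ ∧ q ≠ j₀ ∧ p ≠ q := by
    clear hj₁ hj₀
    revert j₁ j₀; decide
  obtain ⟨r, t, hpr, hpt, hqr, hqt, hrt, hall⟩ : ∃ r t : Fin 4, p ≠ r ∧ p ≠ t ∧ q ≠ r ∧ q ≠ t ∧
      r ≠ t ∧ ∀ i, i ≠ p → i ≠ q → i = r ∨ i = t := by
    clear hp hq
    revert p q; decide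
  have hX : ∀ i, ∃ c : ℝ, (c = 0 ∨ c = 1) ∧ pole c i 1 ∈ normals \ F := by
    intro i
    rcases hF.pole_notMem_or i (Or.inl rfl : (1 : ℝ) = 1 ∨ (1 : ℝ) = -1) with hm | hm
    exacts [⟨1, Or.inr rfl, hm⟩, ⟨0, Or.inl rfl, hm⟩]
  obtain ⟨c, hc, hcm⟩ := hX r
  obtain ⟨d, hd, hdm⟩ := hX t
  have hli := linearIndependent_poles hpq hpr hpt hqr hqt hrt c d
  set v : Fin 6 → Vec 5 := ![pole 1 p 1, pole 1 p (-1), pole 0 q 1, pole 0 q (-1), pole c r 1,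
    pole d t 1] with hv
  let B := basisOfLinearIndependentOfCardEqFinrank hli (by simp)
  have hB : ∀ i, B i = v i := fun i => by simp [B]
  obtain ⟨A, hA, hAB⟩ := exists_skew_of_basis B w (by
    intro i j
    rw [hB, hB]
    -- the six vectors as poles with given cusps, directions and signs
    have hform : ∀ i, v i = pole ((![1, 1, 0, 0, c, d] : Fin 6 → ℝ) i)
        ((![p, p, q, q, r, t] : Fin 6 → Fin 4) i) ((![1, -1, 1, -1, 1, 1] : Fin 6 → ℝ) i) := by
      intro i; fin_cases i <;> rfl
    have hmem : ∀ i, v i ∈ normals \ F := by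
      intro i
      fin_cases i
      exacts [hj₁ p hp _ (Or.inl rfl), hj₁ p hp _ (Or.inr rfl), hj₀ q hq _ (Or.inl rfl),
        hj₀ q hq _ (Or.inr rfl), hcm, hdm]
    have hm := hmem i
    have hm' := hmem j
    rw [hform] at hm hm'
    rw [hform i, hform j]
    refine firstVariation_poles hF hw ?_ ?_ ?_ ?_ hm hm' ?_
    · fin_cases i <;> simp [hc, hd]
    · fin_cases j <;> simp [hc, hd]
    · fin_cases i <;> simp
    · fin_cases j <;> simp
    · fin_cases i <;> fin_cases j <;> simp [hpq, hpr, hpt, hqr, hqt, hrt, hpq.symm, hpr.symm,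
        hpt.symm, hqr.symm, hqt.symm, hrt.symm])
  refine ⟨A, hA, ?_⟩
  set w' : Vec 5 → Vec 5 := fun v => w v - A v with hw'
  have hdef : IsInfinitesimalDeformation (normals \ F) w' := by
    intro x hx y hy hxy
    have h1 := hw x hx y hy hxy
    have h2 := hA x y
    simp only [firstVariation, hw', lform_sub_left, lform_sub_right] at h1 ⊢
    linarith
  have hz : ∀ i, w' (v i) = 0 := fun i => by
    rw [hw', ← hB]
    exact sub_eq_zero.2 (hAB i)
  have hzp : ∀ ε, (ε = 1 ∨ ε = -1) → pole 1 p ε ∈ normals \ F ∧ w' (pole 1 p ε) = 0 := by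
    intro ε hε
    refine ⟨hj₁ p hp _ hε, ?_⟩
    rcases hε with rfl | rfl
    exacts [hz 0, hz 1]
  have hzq : ∀ ε, (ε = 1 ∨ ε = -1) → pole 0 q ε ∈ normals \ F ∧ w' (pole 0 q ε) = 0 := by
    intro ε hε
    refine ⟨hj₀ q hq _ hε, ?_⟩
    rcases hε with rfl | rfl
    exacts [hz 2, hz 3]
  have hzr : ∀ i, i ≠ p → i ≠ q → ∃ d, (d = 0 ∨ d = 1) ∧ pole d i 1 ∈ normals \ F ∧
      w' (pole d i 1) = 0 := by
    intro i hip hiq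
    rcases hall i hip hiq with rfl | rfl
    exacts [⟨c, hc, hcm, hz 4⟩, ⟨d, hd, hdm, hz 5⟩]
  have hpole : ∀ c, (c = 0 ∨ c = 1) → ∀ i ε, (ε = 1 ∨ ε = -1) → pole c i ε ∈ normals \ F →
      w' (pole c i ε) = 0 := by
    intro c hc i ε hε hm
    rcases hc with rfl | rfl
    · exact velocity_pole_eq_zero hF hdef (by norm_num) (Or.inl rfl) hpq.symm hzq hzp
        (fun i hq hp => hzr i hp hq) i hε hm
    · exact velocity_pole_eq_zero hF hdef (by norm_num) (Or.inr rfl) hpq hzp hzq hzr i hε hm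
  intro u hu
  refine sub_eq_zero.1 (?_ : w' u = 0)
  rcases (mem_normals_iff u).1 hu.1 with ⟨c, i, ε, hc, hε, rfl⟩ | ⟨s, k, hs, rfl⟩
  · exact hpole c hc i ε hε hu
  · exact velocity_edge_eq_zero hF hdef hpole hs hu

/-! ### From infinitesimal to local rigidity -/

/-- The Lorentzian inner product as a continuous bilinear map. -/
noncomputable def lformCLM (d : ℕ) : Vec d →L[ℝ] Vec d →L[ℝ] ℝ :=
  (lformBilin d).toContinuousBilinearMap

theorem lformCLM_apply {d : ℕ} (x y : Vec d) : lformCLM d x y = lform x y := rfl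

/-- The Lie algebra of the Lorentz group: the endomorphisms that are skew-adjoint for the Lorentzian
inner product. -/
def lorentzLie (d : ℕ) : Submodule ℝ (Vec d →L[ℝ] Vec d) where
  carrier := {A | ∀ x y, lform (A x) y + lform x (A y) = 0}
  zero_mem' := fun x y => by simp [lform_zero_left, lform_zero_right]
  add_mem' := fun {A B} hA hB x y => by
    simp only [_root_.add_apply, lform_add_left, lform_add_right]
    linarith [hA x y, hB x y]
  smul_mem' := fun c A hA x y => by
    simp only [_root_.smul_apply, lform_smul_left, lform_smul_right]
    rw [← mul_add, hA x y, mul_zero]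

/-- The exponential of a skew-adjoint endomorphism preserves the Lorentzian inner product. -/
theorem lform_exp {d : ℕ} {A : Vec d →L[ℝ] Vec d}
    (hA : ∀ x y, lform (A x) y + lform x (A y) = 0) (x y : Vec d) :
    lform (NormedSpace.exp A x) (NormedSpace.exp A y) = lform x y := by
  have hderiv : ∀ (z : Vec d) (t : ℝ), HasDerivAt (fun t : ℝ => NormedSpace.exp (t • A) z)
      (A (NormedSpace.exp (t • A) z)) t := fun z t =>
    (hasDerivAt_exp_smul_const' A t).clm_apply (hasDerivAt_const t z) |>.congr_deriv (by simp)
  have h : ∀ t : ℝ, HasDerivAt (fun t : ℝ => lformCLM d (NormedSpace.exp (t • A) x)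
      (NormedSpace.exp (t • A) y)) 0 t := fun t => by
    refine (((lformCLM d).hasFDerivAt.comp_hasDerivAt t (hderiv x t)).clm_apply
      (hderiv y t)).congr_deriv ?_
    exact hA _ _
  have := is_const_of_deriv_eq_zero (fun t => (h t).differentiableAt) (fun t => (h t).deriv) 1 0
  simpa [lformCLM_apply] using this

/-- The derivative of the action of the exponential of a small endomorphism on a family of vectors,
jointly in the endomorphism and the family. -/
theorem hasStrictFDerivAt_exp_apply {V X Y ι : Type*} [Fintype ι] [NormedAddCommGroup V]
    [NormedSpace ℝ V] [CompleteSpace V] [NormedAddCommGroup X] [NormedSpace ℝ X]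
    [NormedAddCommGroup Y] [NormedSpace ℝ Y] (e : X →L[ℝ] V →L[ℝ] V) (m : Y →L[ℝ] ι → V)
    (v : ι → V) :
    HasStrictFDerivAt (fun (z : X × Y) i => NormedSpace.exp (e z.1) (v i + m z.2 i))
      (ContinuousLinearMap.pi fun i =>
        ((ContinuousLinearMap.apply ℝ V (v i)).comp e).comp (ContinuousLinearMap.fst ℝ X Y) +
          ((ContinuousLinearMap.proj i).comp m).comp (ContinuousLinearMap.snd ℝ X Y)) 0 := by
  have hexp : HasStrictFDerivAt (fun z : X × Y => NormedSpace.exp (e z.1))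
      (e.comp (ContinuousLinearMap.fst ℝ X Y)) 0 := by
    have h0 : HasStrictFDerivAt (NormedSpace.exp : (V →L[ℝ] V) → V →L[ℝ] V)
        (1 : (V →L[ℝ] V) →L[ℝ] V →L[ℝ] V) (e.comp (ContinuousLinearMap.fst ℝ X Y) 0) := by
      rw [map_zero]; exact hasStrictFDerivAt_exp_zero
    exact h0.comp 0 (e.comp (ContinuousLinearMap.fst ℝ X Y)).hasStrictFDerivAt
  refine hasStrictFDerivAt_pi.2 fun i => ?_
  have h2 : HasStrictFDerivAt (fun z : X × Y => v i + m z.2 i)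
      (((ContinuousLinearMap.proj i).comp m).comp (ContinuousLinearMap.snd ℝ X Y)) 0 :=
    (((ContinuousLinearMap.proj i).comp m).comp
      (ContinuousLinearMap.snd ℝ X Y)).hasStrictFDerivAt.const_add (v i)
  refine (hexp.clm_apply h2).congr_fderiv ?_
  refine ContinuousLinearMap.ext fun z => ?_
  simp [add_comm]

/-- If the infinitesimal transformations `e x` and the displacements `m y` together realise all
velocities of the family `v`, then every family near `v` is the image of some `v + m y` under some
`exp (e x)`, with `x` and `y` small. -/
theorem eventually_exists_exp_apply {V X Y ι : Type*} [Fintype ι] [NormedAddCommGroup V]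
    [NormedSpace ℝ V] [CompleteSpace V] [NormedAddCommGroup X] [NormedSpace ℝ X]
    [FiniteDimensional ℝ X] [NormedAddCommGroup Y] [NormedSpace ℝ Y] [FiniteDimensional ℝ Y]
    (e : X →L[ℝ] V →L[ℝ] V) (m : Y →L[ℝ] ι → V) (v : ι → V)
    (hsurj : ∀ w : ι → V, ∃ x y, ∀ i, w i = e x (v i) + m y i)
    {O : Set (V →L[ℝ] V)} (hO : O ∈ 𝓝 1) {P : Y → Prop} (hP : ∀ᶠ y in 𝓝 0, P y) :
    ∀ᶠ u in 𝓝 v, ∃ x y, NormedSpace.exp (e x) ∈ O ∧ P y ∧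
      ∀ i, u i = NormedSpace.exp (e x) (v i + m y i) := by
  have := FiniteDimensional.complete ℝ X
  have := FiniteDimensional.complete ℝ Y
  have hh := hasStrictFDerivAt_exp_apply e m v
  have hmap := hh.map_nhds_eq_of_surj (by
    rw [eq_top_iff]
    intro w _
    obtain ⟨x, y, hxy⟩ := hsurj w
    refine ⟨(x, y), ?_⟩
    ext i : 1
    simp [hxy])
  simp only [Prod.fst_zero, Prod.snd_zero, map_zero, NormedSpace.exp_zero, Pi.zero_apply, add_zero,
    one_apply_eq_self] at hmap
  rw [← hmap, Filter.eventually_map]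
  have hO' : ∀ᶠ z in 𝓝 (0 : X × Y), NormedSpace.exp (e z.1) ∈ O := by
    have h1 : ContinuousAt (fun x : X => NormedSpace.exp (e x)) 0 := by
      refine ContinuousAt.comp ?_ e.continuous.continuousAt
      rw [map_zero]
      exact (hasFDerivAt_exp_zero (𝕂 := ℝ)).continuousAt
    refine (h1.comp_of_eq continuous_fst.continuousAt rfl).eventually_mem ?_
    simpa using hO
  have hP' : ∀ᶠ z in 𝓝 (0 : X × Y), P z.2 :=
    (continuous_snd.tendsto' (0 : X × Y) 0 rfl).eventually hP
  filter_upwards [hO', hP'] with z hz hz'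
  exact ⟨z.1, z.2, hz, hz', fun i => rfl⟩

/-- Infinitesimal rigidity implies local rigidity for configurations of vectors: if all
infinitesimal deformations of `v` that preserve the inner products `⟨vᵢ, vⱼ⟩` with `E i j` come from
infinitesimal Lorentz transformations, then all configurations near `v` with the same inner
products are the images of `v` under Lorentz transformations close to the identity. -/
theorem eventually_exists_lorentz {d : ℕ} {ι : Type*} [Finite ι] (v : ι → Vec d)
    (E : ι → ι → Prop)
    (hrigid : ∀ w : ι → Vec d, (∀ i j, E i j → lform (w i) (v j) + lform (v i) (w j) = 0) →
      ∃ A : Vec d →ₗ[ℝ] Vec d, (∀ x y, lform (A x) y + lform x (A y) = 0) ∧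
        ∀ i, w i = A (v i))
    {O : Set (Vec d →L[ℝ] Vec d)} (hO : O ∈ 𝓝 1) :
    ∀ᶠ u in 𝓝 v, (∀ i j, E i j → lform (u i) (u j) = lform (v i) (v j)) →
      ∃ g ∈ O, (∀ x y, lform (g x) (g y) = lform x y) ∧ ∀ i, u i = g (v i) := by
  classical
  have := Fintype.ofFinite ι
  -- the prescribed inner products, and their derivative at `v`
  let Φ : (ι → Vec d) → ι × ι → ℝ := fun u p =>
    if E p.1 p.2 then lformCLM d (u p.1) (u p.2) else 0
  let dΦ : (ι → Vec d) →L[ℝ] ι × ι → ℝ := ContinuousLinearMap.pi fun p =>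
    if E p.1 p.2 then
      ((lformCLM d).flip (v p.2)).comp (ContinuousLinearMap.proj p.1) +
        (lformCLM d (v p.1)).comp (ContinuousLinearMap.proj p.2)
    else 0
  have hdΦ : ∀ w, dΦ w = 0 → ∃ A ∈ lorentzLie d, ∀ i, w i = A (v i) := by
    intro w hw
    obtain ⟨A, hA, hAw⟩ := hrigid w fun i j hij => by
      have := congrFun hw (i, j)
      simpa [dΦ, hij, lformCLM_apply] using this
    exact ⟨LinearMap.toContinuousLinearMap A, hA, hAw⟩
  have hΦ : HasFDerivAt Φ dΦ v := by
    refine hasFDerivAt_pi.2 fun p => ?_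
    by_cases hp : E p.1 p.2
    · simp only [hp, if_true]
      refine ((((lformCLM d).hasFDerivAt).comp v (hasFDerivAt_apply p.1 v)).clm_apply
        (hasFDerivAt_apply p.2 v)).congr_fderiv ?_
      ext w
      simp [add_comm]
    · simp only [hp, if_false]
      exact hasFDerivAt_const _ _
  obtain ⟨N, hN⟩ := Submodule.exists_isCompl (LinearMap.ker dΦ.toLinearMap)
  -- the slice meets the configurations with the prescribed inner products only in `v`
  have hslice : ∀ᶠ s : N in 𝓝 (0 : N), Φ (v + (s : ι → Vec d)) = Φ v → s = 0 := by
    have hΦN : HasFDerivAt (fun s : N => Φ (v + (s : ι → Vec d))) (dΦ.comp N.subtypeL) 0 := by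
      have h1 : HasFDerivAt (fun s : N => v + (s : ι → Vec d)) N.subtypeL 0 :=
        (ContinuousLinearMap.hasFDerivAt (x := (0 : N)) N.subtypeL).const_add v
      exact HasFDerivAt.comp (g := Φ) (g' := dΦ) (0 : N) (by simpa using hΦ) h1
    have hinj : LinearMap.ker (dΦ.comp N.subtypeL).toLinearMap = ⊥ := by
      rw [eq_bot_iff]
      intro s hs
      have : (s : ι → Vec d) ∈ LinearMap.ker dΦ.toLinearMap ⊓ N := ⟨hs, s.2⟩
      rw [hN.inf_eq_bot] at this
      exact Subtype.ext this
    obtain ⟨K, -, hK⟩ := LinearMap.exists_antilipschitzWith _ hinj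
    have := hΦN.eventually_ne (c := Φ v) ⟨K, hK⟩
    rw [eventually_nhdsWithin_iff] at this
    filter_upwards [this] with s hs h1
    by_contra h2
    exact hs h2 h1
  -- every nearby configuration is a Lorentz transform of one in the slice `v + N`
  have hnear := eventually_exists_exp_apply (X := lorentzLie d) (Y := N)
    (lorentzLie d).subtypeL N.subtypeL v (fun w => by
    have hw : w ∈ LinearMap.ker dΦ.toLinearMap ⊔ N := by rw [hN.sup_eq_top]; trivial
    obtain ⟨k, hk, s, hs, rfl⟩ := Submodule.mem_sup.1 hw
    obtain ⟨A, hA, hAk⟩ := hdΦ k hk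
    exact ⟨⟨A, hA⟩, ⟨s, hs⟩, fun i => by simp [hAk]⟩) hO hslice
  filter_upwards [hnear] with u ⟨A, s, hAO, hs, hu⟩ hE
  have hsA := lform_exp A.2
  have hs0 : s = 0 := hs (by
    ext p
    by_cases hp : E p.1 p.2
    · have h1 := hE _ _ hp
      rw [hu, hu] at h1
      simp only [Φ, hp, if_true]
      exact (hsA _ _).symm.trans h1
    · simp only [Φ, hp, if_false])
  refine ⟨NormedSpace.exp (A : Vec d →L[ℝ] Vec d), hAO, hsA, fun i => ?_⟩
  rw [hu, hs0]
  simp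

/-! ### Involutions close to a reflection -/

theorem Isom.ext_mulVec {d : ℕ} {g h : Isom d} (H : ∀ x, g.1.1 *ᵥ x = h.1.1 *ᵥ x) : g = h :=
  Subtype.ext (Units.ext (Matrix.mulVec_injective (funext H)))

theorem continuous_isom_val (d : ℕ) : Continuous fun g : Isom d => g.1.1 :=
  Units.continuous_val.comp continuous_subtype_val

theorem continuous_lform (d : ℕ) : Continuous fun p : Vec d × Vec d => lform p.1 p.2 := by
  unfold lform
  fun_prop

theorem continuous_reflMatrix (d : ℕ) : Continuous (reflMatrix : Vec d → _) := by
  refine continuous_matrix fun i j => ?_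
  simp only [reflMatrix, LinearMap.toMatrix'_apply, LinearMap.coe_mk, AddHom.coe_mk, reflVec, lform]
  fun_prop

/-- Isometric involutions close to a reflection are reflections, and their normal vectors can be
chosen to depend continuously on them. -/
theorem exists_normal_of_involution {d : ℕ} (v : UnitSpacelike d) :
    ∃ c : Isom d → Vec d, ContinuousAt c (reflection v) ∧ c (reflection v) = v.1 ∧
      ∀ᶠ R in 𝓝 (reflection v), R * R = 1 →
        ∃ u : UnitSpacelike d, u.1 = c R ∧ R = reflection u := by
  -- `v - R v` lies in the `-1`-eigenspace of an involution `R`, and equals `2 v` for `R = r_v`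
  let w : Isom d → Vec d := fun R => (1 / 2 : ℝ) • (v.1 - R.1.1 *ᵥ v.1)
  let c : Isom d → Vec d := fun R => (√(lform (w R) (w R)))⁻¹ • w R
  have hval := continuous_isom_val d
  have hw : Continuous w := by
    have h1 : Continuous fun R : Isom d => R.1.1 *ᵥ v.1 := hval.matrix_mulVec continuous_const
    exact (continuous_const.sub h1).const_smul (1 / 2 : ℝ)
  have hwv : w (reflection v) = v.1 := by
    have h1 : (reflection v).1.1 *ᵥ v.1 = -v.1 := by
      change reflMatrix v.1 *ᵥ v.1 = _
      rw [reflMatrix_mulVec, reflVec, v.2]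
      module
    simp only [w, h1]
    module
  have hcv : c (reflection v) = v.1 := by
    simp only [c, hwv, v.2]
    simp
  have hlw : Continuous fun R => lform (w R) (w R) := (continuous_lform d).comp (hw.prodMk hw)
  have hc : ContinuousAt c (reflection v) := by
    refine ContinuousAt.smul (ContinuousAt.inv₀ (hlw.sqrt.continuousAt) ?_) hw.continuousAt
    rw [hwv, v.2]
    simp
  refine ⟨c, hc, hcv, ?_⟩
  have hpos : ∀ᶠ R in 𝓝 (reflection v), 0 < lform (w R) (w R) := by
    refine hlw.continuousAt.eventually_mem (Ioi_mem_nhds ?_)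
    rw [hwv, v.2]
    exact one_pos
  have hdet : ∀ᶠ R in 𝓝 (reflection v), (reflMatrix (c R) * R.1.1 + 1).det ≠ 0 := by
    have h1 : ContinuousAt (fun R => (reflMatrix (c R) * R.1.1 + 1).det) (reflection v) := by
      have h2 : ContinuousAt (fun R => reflMatrix (c R)) (reflection v) :=
        (continuous_reflMatrix d).continuousAt.comp hc
      have h3 : ContinuousAt (fun R => reflMatrix (c R) * R.1.1 + 1) (reflection v) :=
        (h2.mul hval.continuousAt).add continuousAt_const
      exact (continuous_id.matrix_det).continuousAt.comp h3
    refine h1.eventually_ne ?_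
    rw [hcv]
    change (reflMatrix v.1 * reflMatrix v.1 + 1).det ≠ 0
    rw [reflMatrix_mul_self v.1 v.2, one_add_one_eq_two]
    have : (2 : Matrix (Fin (d + 1)) (Fin (d + 1)) ℝ) = (2 : ℝ) • 1 := by
      rw [two_smul, one_add_one_eq_two]
    rw [this, Matrix.det_smul, Matrix.det_one]
    positivity
  filter_upwards [hpos, hdet] with R hR hQ hinv
  have hRR : R.1.1 * R.1.1 = 1 := congrArg (fun g : Isom d => g.1.1) hinv
  have hRw : R.1.1 *ᵥ w R = -w R := by
    simp only [w]
    rw [mulVec_smul, mulVec_sub, mulVec_mulVec, hRR, one_mulVec]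
    module
  have hRc : R.1.1 *ᵥ c R = -c R := by
    simp only [c]
    rw [mulVec_smul, hRw, smul_neg]
  have hcc : lform (c R) (c R) = 1 := by
    have key : ∀ (k : ℝ) (x : Vec d), lform (k • x) (k • x) = k ^ 2 * lform x x := fun k x => by
      rw [lform_smul_left, lform_smul_right]; ring
    change lform (_ • w R) (_ • w R) = 1
    rw [key, inv_pow, Real.sq_sqrt hR.le, inv_mul_cancel₀ hR.ne']
  refine ⟨⟨c R, hcc⟩, rfl, ?_⟩
  set S := reflMatrix (c R) with hS
  set M := R.1.1 with hM
  have hSS : S * S = 1 := reflMatrix_mul_self _ hcc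
  have hcomm : S * M = M * S := by
    refine Matrix.mulVec_injective (funext fun x => ?_)
    have h1 : lform (M *ᵥ x) (c R) = - lform x (c R) := by
      have h2 := R.2.1 x (c R)
      rw [← hM, hRc, ← neg_one_smul ℝ (c R), lform_smul_right] at h2
      linarith
    rw [← mulVec_mulVec, ← mulVec_mulVec, reflMatrix_mulVec, reflMatrix_mulVec, reflVec, reflVec,
      mulVec_sub, mulVec_smul, hRc, h1]
    module
  -- the product of `R` and the reflection in `c R` is an involution close to the identity
  have hsq : (S * M + 1) * (S * M - 1) = 0 := by
    have h1 : S * M * (S * M) = 1 := by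
      calc S * M * (S * M) = S * (M * S) * M := by simp only [mul_assoc]
        _ = (S * S) * (M * M) := by rw [← hcomm]; simp only [mul_assoc]
        _ = 1 := by rw [hSS, hRR, one_mul]
    rw [add_mul, mul_sub, h1]
    simp
  have hunit : IsUnit (S * M + 1) :=
    (Matrix.isUnit_iff_isUnit_det _).2 (isUnit_iff_ne_zero.2 hQ)
  have hone : S * M = 1 := sub_eq_zero.1 ((hunit.mul_right_eq_zero).1 hsq)
  have hMS : M = S := by
    calc M = S * S * M := by rw [hSS, one_mul]
      _ = S := by rw [mul_assoc, hone, mul_one]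
  exact Subtype.ext (Units.ext hMS)

/-- Reflections with orthogonal normal vectors commute. -/
theorem reflection_mul_comm {d : ℕ} {u v : UnitSpacelike d} (h : lform u.1 v.1 = 0) :
    reflection u * reflection v = reflection v * reflection u := by
  refine Isom.ext_mulVec fun x => ?_
  change (reflMatrix u.1 * reflMatrix v.1) *ᵥ x = (reflMatrix v.1 * reflMatrix u.1) *ᵥ x
  rw [← mulVec_mulVec, ← mulVec_mulVec]
  simp only [reflMatrix_mulVec, reflVec, lform_sub_left, lform_smul_left, h, lform_comm v.1 u.1]
  module

/-- The inner product `c` of the normal vectors of two commuting reflections satisfies `c = c³`, so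
that it vanishes if it is small. -/
theorem lform_eq_zero_of_reflection_mul_comm {d : ℕ} {u v : UnitSpacelike d}
    (h : reflection u * reflection v = reflection v * reflection u) (hlt : |lform u.1 v.1| < 1) :
    lform u.1 v.1 = 0 := by
  have h1 : (reflMatrix u.1 * reflMatrix v.1) *ᵥ v.1 = (reflMatrix v.1 * reflMatrix u.1) *ᵥ v.1 :=
    congrArg (fun g : Isom d => g.1.1 *ᵥ v.1) h
  rw [← mulVec_mulVec, ← mulVec_mulVec] at h1
  have h2 := congrArg (fun x => lform x u.1) h1
  simp only [reflMatrix_mulVec, reflVec, lform_sub_left, lform_smul_left, v.2, u.2,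
    lform_comm v.1 u.1] at h2
  have h3 : lform u.1 v.1 * (1 - lform u.1 v.1 ^ 2) = 0 := by linear_combination h2 / 4
  have h4 : lform u.1 v.1 ^ 2 < 1 := (sq_lt_one_iff_abs_lt_one _).2 hlt
  exact (mul_eq_zero.1 h3).resolve_right (by linarith)

/-- Conjugating a reflection moves its normal vector. -/
theorem conj_reflection {d : ℕ} (g : Isom d) {u v : UnitSpacelike d} (h : u.1 = g.1.1 *ᵥ v.1) :
    reflection u = g * reflection v * g⁻¹ := by
  rw [eq_mul_inv_iff_mul_eq]
  refine Isom.ext_mulVec fun x => ?_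
  change (reflMatrix u.1 * g.1.1) *ᵥ x = (g.1.1 * reflMatrix v.1) *ᵥ x
  rw [← mulVec_mulVec, ← mulVec_mulVec, reflMatrix_mulVec, reflMatrix_mulVec, reflVec, reflVec, h,
    mulVec_sub, mulVec_smul, g.2.1]

/-! ### Lorentz transformations that preserve the hyperboloid -/

/-- The inner product of two unit time-like vectors has the opposite sign of the product of their
time coordinates. -/
theorem lform_neg_iff {d : ℕ} {x y : Vec d} (hx : lform x x = -1) (hy : lform y y = -1) :
    lform x y < 0 ↔ 0 < x (Fin.last d) * y (Fin.last d) := by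
  have cs := Finset.sum_mul_sq_le_sq_mul_sq Finset.univ
    (fun i : Fin d => x i.castSucc) (fun i : Fin d => y i.castSucc)
  simp only [lform, ← pow_two] at hx hy
  unfold lform
  set s := ∑ i : Fin d, x i.castSucc * y i.castSucc
  set p := x (Fin.last d)
  set q := y (Fin.last d)
  have e1 : ∑ i : Fin d, x i.castSucc ^ 2 = p ^ 2 - 1 := by linarith
  have e2 : ∑ i : Fin d, y i.castSucc ^ 2 = q ^ 2 - 1 := by linarith
  have n1 : 0 ≤ p ^ 2 - 1 := e1 ▸ Finset.sum_nonneg fun i _ => sq_nonneg _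
  have n2 : 0 ≤ q ^ 2 - 1 := e2 ▸ Finset.sum_nonneg fun i _ => sq_nonneg _
  rw [e1, e2] at cs
  have hlt : s ^ 2 < (p * q) ^ 2 := by nlinarith
  have habs := sq_lt_sq.1 hlt
  constructor
  · intro h
    by_contra h0
    rw [abs_of_nonpos (not_lt.1 h0)] at habs
    linarith [neg_abs_le s]
  · intro h
    rw [abs_of_pos h] at habs
    linarith [le_abs_self s]

/-- The point of the hyperboloid on the time axis. -/
noncomputable def origin (d : ℕ) : Vec d := Pi.single (Fin.last d) 1

theorem lform_origin {d : ℕ} (x : Vec d) : lform x (origin d) = - x (Fin.last d) := by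
  simp [lform, origin, Fin.castSucc_ne_last]

/-- An invertible Lorentz transformation that maps one point of the hyperboloid to its upper sheet
belongs to the positive Lorentz group. -/
theorem exists_isom {d : ℕ} {g : Vec d →L[ℝ] Vec d} (hg : IsUnit g)
    (hpres : ∀ x y, lform (g x) (g y) = lform x y) (hpos : 0 < g (origin d) (Fin.last d)) :
    ∃ B : Isom d, ∀ x, B.1.1 *ᵥ x = g x := by
  obtain ⟨U, rfl⟩ := hg
  have hoo : lform (origin d) (origin d) = -1 := by rw [lform_origin]; simp [origin]
  have hgo : lform (U.1 (origin d)) (U.1 (origin d)) = -1 := by rw [hpres, hoo]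
  have hsheet : ∀ x, U.1 x ∈ hyperboloid d ↔ x ∈ hyperboloid d := by
    intro x
    refine ⟨fun h => ?_, fun h => ?_⟩
    · have h1 : lform x x = -1 := by rw [← hpres, h.1]
      have h2 := (lform_neg_iff h.1 hgo).2 (mul_pos h.2 hpos)
      rw [hpres, lform_origin] at h2
      exact ⟨h1, by linarith⟩
    · have h1 : lform (U.1 x) (U.1 x) = -1 := by rw [hpres, h.1]
      have h2 : lform (U.1 x) (U.1 (origin d)) < 0 := by
        rw [hpres, lform_origin]; linarith [h.2]
      exact ⟨h1, pos_of_mul_pos_left ((lform_neg_iff h1 hgo).1 h2) hpos.le⟩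
  let G : GL (Fin (d + 1)) ℝ := ⟨LinearMap.toMatrix' U.1.toLinearMap,
    LinearMap.toMatrix' U.2.toLinearMap, by
      rw [← LinearMap.toMatrix'_mul, ← LinearMap.toMatrix'_one]
      exact congrArg (fun f : Vec d →L[ℝ] Vec d => LinearMap.toMatrix' f.toLinearMap) U.val_inv, by
      rw [← LinearMap.toMatrix'_mul, ← LinearMap.toMatrix'_one]
      exact congrArg (fun f : Vec d →L[ℝ] Vec d => LinearMap.toMatrix' f.toLinearMap) U.inv_val⟩
  have hG : ∀ x, G.1 *ᵥ x = U.1 x := fun x => LinearMap.toMatrix'_mulVec _ x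
  exact ⟨⟨G, fun x y => by rw [hG, hG, hpres], fun x => by rw [hG, hsheet]⟩, hG⟩

/-! ### Local rigidity -/

theorem continuous_repSpace_apply {d : ℕ} {Γ : Subgroup (Isom d)} (γ : Γ) :
    Continuous fun ρ : RepSpace Γ => ρ γ :=
  (continuous_apply γ).comp continuous_induced_dom

/-- Near the inclusion, every representation sends the generating reflections to reflections, and
is conjugate to the inclusion. -/
theorem eventually_conj_inclusionRep {F : Set (Vec 5)} (hF : OrthogonalFree F) :
    ∀ᶠ ρ in 𝓝 (inclusionRep (reflectionGroup (normals \ F))),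
      (∀ r : reflectionGroup (normals \ F), (r : Isom 5) ∈ reflections (normals \ F) →
        ∃ u : UnitSpacelike 5, ρ r = reflection u) ∧
      ∃ f : Isom 5, ∀ γ : reflectionGroup (normals \ F),
        f * ρ γ * f⁻¹ = inclusionRep (reflectionGroup (normals \ F)) γ := by
  classical
  set Γ := reflectionGroup (normals \ F)
  have : Finite ↥(normals \ F) := (finite_normals.subset Set.sdiff_subset).to_subtype
  let n : ↥(normals \ F) → UnitSpacelike 5 := fun s => ⟨s.1, normals_unit s.2.1⟩
  let r : ↥(normals \ F) → Γ := fun s =>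
    ⟨reflection (n s), Subgroup.subset_closure ⟨n s, s.2, rfl⟩⟩
  choose c hc hcv hcR using fun s => exists_normal_of_involution (n s)
  -- the configuration of normal vectors of the images of the generators
  let W : RepSpace Γ → ↥(normals \ F) → Vec 5 := fun ρ s => c s (ρ (r s))
  let v : ↥(normals \ F) → Vec 5 := fun s => s.1
  have htend : ∀ s, Filter.Tendsto (fun ρ : RepSpace Γ => ρ (r s)) (𝓝 (inclusionRep Γ))
      (𝓝 (reflection (n s))) := fun s => (continuous_repSpace_apply (r s)).tendsto _
  have hW : Filter.Tendsto W (𝓝 (inclusionRep Γ)) (𝓝 v) := by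
    refine tendsto_pi_nhds.2 fun s => ?_
    have h1 : Filter.Tendsto (c s) (𝓝 (reflection (n s))) (𝓝 (v s)) := by
      have := hc s
      rwa [ContinuousAt, hcv s] at this
    exact h1.comp (htend s)
  let E : ↥(normals \ F) → ↥(normals \ F) → Prop := fun s t => s = t ∨ lform (v s) (v t) = 0
  have hO : {g : Vec 5 →L[ℝ] Vec 5 | IsUnit g} ∩ {g | 0 < g (origin 5) (Fin.last 5)} ∈
      𝓝 (1 : Vec 5 →L[ℝ] Vec 5) := by
    refine Filter.inter_mem (Units.isOpen.mem_nhds isUnit_one) (IsOpen.mem_nhds ?_ ?_)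
    · refine isOpen_lt continuous_const ?_
      exact (continuous_apply _).comp (ContinuousLinearMap.apply ℝ (Vec 5) (origin 5)).continuous
    · simp [origin]
  have hnear := eventually_exists_lorentz v E (fun w hw => by
    let w' : Vec 5 → Vec 5 := fun x => if h : x ∈ normals \ F then w ⟨x, h⟩ else 0
    have hw's : ∀ s : ↥(normals \ F), w' s.1 = w s := fun s => dif_pos s.2
    have hdef : IsInfinitesimalDeformation (normals \ F) w' := by
      intro x hx y hy hxy
      have h1 := hw ⟨x, hx⟩ ⟨y, hy⟩ (hxy.imp (fun h => Subtype.ext h) id)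
      rwa [← hw's, ← hw's] at h1
    obtain ⟨A, hA, hAw⟩ := hdef.exists_skew hF
    exact ⟨A, hA, fun s => (hw's s).symm.trans (hAw s.1 s.2)⟩) hO
  have hsmall : ∀ s t, lform (v s) (v t) = 0 →
      ∀ᶠ u in 𝓝 v, |lform (u s) (u t)| < 1 := by
    intro s t hst
    have h1 : Continuous fun u : ↥(normals \ F) → Vec 5 => lform (u s) (u t) :=
      (continuous_lform 5).comp (f := fun u : ↥(normals \ F) → Vec 5 => (u s, u t)) (by fun_prop)
    refine h1.abs.continuousAt.eventually_mem (Iio_mem_nhds ?_)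
    rw [hst, abs_zero]
    exact one_pos
  have hsmall' : ∀ᶠ u in 𝓝 v, ∀ s t, lform (v s) (v t) = 0 → |lform (u s) (u t)| < 1 := by
    simp only [Filter.eventually_all]
    exact hsmall
  have hrefl : ∀ᶠ ρ : RepSpace Γ in 𝓝 (inclusionRep Γ), ∀ s, ρ (r s) * ρ (r s) = 1 →
      ∃ u : UnitSpacelike 5, u.1 = W ρ s ∧ ρ (r s) = reflection u :=
    Filter.eventually_all.2 fun s => (htend s).eventually (hcR s)
  filter_upwards [hW.eventually hnear, hW.eventually hsmall', hrefl] with ρ h1 h2 h3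
  have hinv : ∀ s, ρ (r s) * ρ (r s) = 1 := by
    intro s
    have h4 : r s * r s = 1 :=
      Subtype.ext (Subtype.ext (Units.ext (reflMatrix_mul_self s.1 (normals_unit s.2.1))))
    rw [← map_mul, h4, map_one]
  choose u huW hu using fun s => h3 s (hinv s)
  obtain ⟨g, ⟨hgu, hgp⟩, hpres, hg⟩ := h1 fun s t hst => by
    rw [← huW, ← huW]
    by_cases h : s = t
    · subst h
      rw [(u s).2]
      exact (n s).2.symm
    · have h5 := hst.resolve_left h
      have h6 : r s * r t = r t * r s := Subtype.ext (reflection_mul_comm (u := n s) (v := n t) h5)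
      rw [h5]
      refine lform_eq_zero_of_reflection_mul_comm ?_ ?_
      · rw [← hu, ← hu, ← map_mul, h6, map_mul]
      · rw [huW, huW]
        exact h2 s t h5
  obtain ⟨B, hB⟩ := exists_isom hgu hpres hgp
  have hconj : ∀ s, B⁻¹ * ρ (r s) * B⁻¹⁻¹ = r s := by
    intro s
    have h7 : (u s).1 = B.1.1 *ᵥ (n s).1 := by rw [hB, huW, hg]
    rw [hu, conj_reflection B h7]
    change _ = reflection (n s)
    group
  have hgen : ∀ x ∈ reflections (normals \ F), ∃ s, (r s : Isom 5) = x := by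
    rintro x ⟨y, hy, rfl⟩
    exact ⟨⟨y.1, hy⟩, rfl⟩
  refine ⟨fun x hx => ?_, B⁻¹, fun γ => ?_⟩
  · obtain ⟨s, hs⟩ := hgen x hx
    obtain rfl : r s = x := Subtype.ext hs
    exact ⟨u s, hu s⟩
  · obtain ⟨x, hx⟩ := γ
    change B⁻¹ * ρ ⟨x, hx⟩ * B⁻¹⁻¹ = x
    induction hx using Subgroup.closure_induction with
    | mem x hx =>
      obtain ⟨s, rfl⟩ := hgen x hx
      exact hconj s
    | one => rw [show (⟨1, _⟩ : Γ) = 1 from rfl, map_one]; group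
    | mul x y hx hy ihx ihy =>
      rw [show (⟨x * y, _⟩ : Γ) = ⟨x, hx⟩ * ⟨y, hy⟩ from rfl, map_mul]
      calc _ = (B⁻¹ * ρ ⟨x, hx⟩ * B⁻¹⁻¹) * (B⁻¹ * ρ ⟨y, hy⟩ * B⁻¹⁻¹) := by group
        _ = x * y := by rw [ihx, ihy]
    | inv x hx ih =>
      rw [show (⟨x⁻¹, _⟩ : Γ) = ⟨x, hx⟩⁻¹ from rfl, map_inv]
      calc _ = (B⁻¹ * ρ ⟨x, hx⟩ * B⁻¹⁻¹)⁻¹ := by group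
        _ = x⁻¹ := by rw [ih]

theorem orthogonalFree_of_disjoint {F : Set (Vec 5)} (hF : F ⊆ normals)
    (hdisj : F.Pairwise fun v w => Disjoint (facet normals v) (facet normals w)) :
    OrthogonalFree F := by
  intro v hv w hw h
  by_cases hvw : v = w
  · rw [hvw, normals_unit (hF hw)] at h
    exact one_ne_zero h
  · exact not_disjoint_facet (hF hv) (hF hw) h (hdisj hv hw hvw)

end HypRACG

theorem mainTheorem1 (F : Set (HypRACG.Vec 5)) (hF : F ⊆ HypRACG.normals)
    (hdisj : F.Pairwise fun v w =>
      Disjoint (HypRACG.facet HypRACG.normals v) (HypRACG.facet HypRACG.normals w)) :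
    (∃ U₀ : Set (HypRACG.RepSpace (HypRACG.reflectionGroup (HypRACG.normals \ F))),
      IsOpen U₀ ∧
      HypRACG.inclusionRep (HypRACG.reflectionGroup (HypRACG.normals \ F)) ∈ U₀ ∧
      (∀ ρ ∈ U₀, ∀ r : HypRACG.reflectionGroup (HypRACG.normals \ F),
        (r : HypRACG.Isom 5) ∈ HypRACG.reflections (HypRACG.normals \ F) →
          ∃ u : HypRACG.UnitSpacelike 5, ρ r = HypRACG.reflection u) ∧
      ∀ ρ ∈ U₀, ∃ f : HypRACG.Isom 5,
        ∀ γ : HypRACG.reflectionGroup (HypRACG.normals \ F),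
          f * ρ γ * f⁻¹ =
            HypRACG.inclusionRep (HypRACG.reflectionGroup (HypRACG.normals \ F)) γ) ∧
    HypRACG.LocallyRigid (HypRACG.reflectionGroup (HypRACG.normals \ F)) := by
  have hev := HypRACG.eventually_conj_inclusionRep (HypRACG.orthogonalFree_of_disjoint hF hdisj)
  obtain ⟨U, hU, hUo, hmem⟩ := eventually_nhds_iff.1 hev
  refine ⟨⟨U, hUo, hmem, fun ρ hρ => (hU ρ hρ).1, fun ρ hρ => (hU ρ hρ).2⟩,
    U, hUo.mem_nhds hmem, fun ρ hρ => ?_⟩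
  obtain ⟨f, hf⟩ := (hU ρ hρ).2
  refine ⟨f⁻¹, fun γ => ?_⟩
  rw [← hf γ]
  group
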